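/- Let $B>0$. For $m\in\mathbb N_0$ let $\phi_m$ be the function on $\mathbb R^2$ given in polar coordinates $(r,\varphi)$ by $$\phi_m(x^\perp)=\sqrt{\frac{B}{2\pi}}\,\frac1{\sqrt{m!}}\Big(\frac{Br^2}{2}\Big)^{m/2}e^{-im\varphi}e^{-Br^2/4}.$$ Let $(n_m)_{m\ge0}$ be nonnegative integers, only finitely many of them nonzero, and let $N=\sum_m n_m$. For each $m$ let $\psi_m\in L^2(\mathbb R^{n_m};\mathbb C)$ be normalized and antisymmetric in all its variables. Points of $\mathbb R^3$ are written $\mathbf x=(x^\perp,z)$ with $x^\perp\in\mathbb R^2$, $z\in\mathbb R$. Let $\Psi\in L^2(\mathbb R^{3N})$ be the normalized total antisymmetrization in the variables $\mathbf x_1,\dots,\mathbf x_N$ of the tensor product over $m$ of the functions $$\psi_m(z_1,\dots,z_{n_m})\prod_{i=1}^{n_m}\phi_m(x_i^\perp),$$ that is, $\Psi=(N!\prod_m n_m!)^{-1/2}\sum_{\sigma\in S_N}\operatorname{sgn}(\sigma)\,\Phi(\mathbf x_{\sigma(1)},\dots,\mathbf x_{\sigma(N)})$, where $\Phi$ is this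 tensor product. For a $k$-particle wave function $\psi$ on $X^k$ ($X=\mathbb R$ or $\mathbb R^3$), the density of $\psi$ is $$\rho_\psi(x)=\sum_{i=1}^k\int_{X^{k-1}}|\psi(x_1,\dots,x_{i-1},x,x_{i+1},\dots,x_k)|^2\,dx_1\cdots dx_{i-1}\,dx_{i+1}\cdots dx_k .$$ Let $\rho_m$ be the density of $\psi_m$ on $\mathbb R$, let $\rho_\Psi$ be the density of $\Psi$ on $\mathbb R^3$, and let $$D(\rho,\rho)=\frac12\int_{\mathbb R^3}\int_{\mathbb R^3}\frac{\rho(\mathbf x)\rho(\mathbf y)}{|\mathbf x-\mathbf y|}\,d\mathbf x\,d\mathbf y .$$ Suppose that $S:=\sum_m\int_{\mathbb R}\rho_m^3<\infty$. Then $\langle\Psi|\sum_{i<j}|\mathbf x_i-\mathbf x_j|^{-1}\Psi\rangle$ and $D(\rho_\Psi,\rho_\Psi)$ are finite, and $$\Big\langle\Psi\Big|\sum_{i<j}\frac1{|\mathbf x_i-\mathbf x_j|}\Psi\Big\rangle\ \ge\ D(\rho_\Psi,\rho_\Psi)-N^{1/2}\sqrt S\left(\frac{33}2\ln\Big[e^3+\sqrt{\frac{BN}{S}}\,\Big]+33+\frac14\ln\frac\pi2\right).$$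 (For $N=0$ both sides are $0$.) -/

import Mathlib

open MeasureTheory
open scoped ENNReal

noncomputable section

namespace LandauBand

/-- Three-dimensional space, split as (plane orthogonal to the magnetic field) × (field axis).
A point is `(w, z)`, where the orthogonal plane `ℝ²` is identified with `ℂ` through `w = x + i y`;
the measure is Lebesgue measure. (The norm of this product type is not used.) -/
abbrev Space : Type := ℂ × ℝ

/-- The Euclidean distance of two points of three-dimensional space. -/
def euclDist (x y : Space) : ℝ := Real.sqrt (‖x.1 - y.1‖ ^ 2 + (x.2 - y.2) ^ 2)

/-- The Coulomb potential `1 / |x - y|`, equal to `∞` for `x = y`. -/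
def coulomb (x y : Space) : ℝ≥0∞ := (ENNReal.ofReal (euclDist x y))⁻¹

/-- The one-particle density
`ρ(x) = ∑ i, ∫ |ψ(x₁, …, x_{i-1}, x, x_{i+1}, …, x_N)|² dx₁ … dx_{i-1} dx_{i+1} … dx_N`:
in the `i`-th summand all variables but the `i`-th are integrated out, and the `i`-th one is `x`. -/
def density {X : Type*} [MeasureSpace X] {N : ℕ} (ψ : (Fin N → X) → ℂ) (x : X) : ℝ≥0∞ :=
  ∑ i : Fin N,
    lmarginal (fun _ : Fin N => (volume : Measure X)) (Finset.univ.erase i)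
      (fun y : Fin N → X => ‖ψ y‖ₑ ^ 2) (fun _ => x)

/-- `⟨Ψ | ∑_{i<j} 1/|x_i - x_j| | Ψ⟩`, as an integral of a nonnegative function. -/
def coulombEnergy {N : ℕ} (Ψ : (Fin N → Space) → ℂ) : ℝ≥0∞ :=
  ∫⁻ x : Fin N → Space, (∑ i : Fin N, ∑ j ∈ Finset.Ioi i, coulomb (x i) (x j)) * ‖Ψ x‖ₑ ^ 2

/-- The direct energy `D(ρ, ρ) = ½ ∫∫ ρ(x) ρ(y) / |x - y| dx dy`. -/
def directEnergy (ρ : Space → ℝ≥0∞) : ℝ≥0∞ :=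
  2⁻¹ * ∫⁻ x : Space, ∫⁻ y : Space, ρ x * ρ y * coulomb x y

/-- The function `φ_m` of the lowest Landau band with angular momentum `-m`, in polar coordinates
`r = ‖w‖`, `φ = arg w` of the orthogonal plane:
`√(B/2π) (m!)^{-1/2} (B r²/2)^{m/2} e^{-imφ} e^{-B r²/4}`. -/
def phi (B : ℝ) (m : ℕ) (w : ℂ) : ℂ :=
  ((Real.sqrt (B / (2 * Real.pi)) * (1 / Real.sqrt (m.factorial : ℝ)) *
      (B * ‖w‖ ^ 2 / 2) ^ ((m : ℝ) / 2) * Real.exp (-(B * ‖w‖ ^ 2) / 4) : ℝ) : ℂ) *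
    Complex.exp (-(Complex.I * (m : ℂ) * (Complex.arg w : ℂ)))

/-- Antisymmetry of an element of `L²(ℝ^k)` in all of its variables. -/
def IsAntisymmetric {k : ℕ} (ψ : Lp ℂ 2 (volume : Measure (Fin k → ℝ))) : Prop :=
  ∀ σ : Equiv.Perm (Fin k), ∀ᵐ z : Fin k → ℝ,
    ψ (fun i => z (σ i)) = ((Equiv.Perm.sign σ : ℤ) : ℂ) * ψ z

/-- The tensor product over `m < M` of the functions
`ψ_m(z_1, …, z_{n_m}) ∏_{i ≤ n_m} φ_m(x_i^⊥)`; the `N = ∑ m, n_m` particle labels are distributed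
over the blocks in consecutive order by `finSigmaFinEquiv`. -/
def productState (B : ℝ) {M : ℕ} (n : Fin M → ℕ)
    (ψ : ∀ m : Fin M, Lp ℂ 2 (volume : Measure (Fin (n m) → ℝ)))
    (x : Fin (∑ m, n m) → Space) : ℂ :=
  ∏ m : Fin M,
    (ψ m (fun i => (x (finSigmaFinEquiv ⟨m, i⟩)).2) *
      ∏ i : Fin (n m), phi B (m : ℕ) (x (finSigmaFinEquiv ⟨m, i⟩)).1)

/-- The normalized total antisymmetrization
`Ψ(x) = (N! ∏ m, n_m!)^{-1/2} ∑_{σ ∈ S_N} sgn(σ) Φ(x_{σ(1)}, …, x_{σ(N)})` of the tensor product `Φ`.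
As the `φ_m` are orthonormal and the `ψ_m` are antisymmetric of norm one, the unnormalized sum has
squared norm `N! ∏ m, n_m!`: it consists of `N! / ∏ m, n_m!` mutually orthogonal terms, each of
which occurs `∏ m, n_m!` times. -/
def antisymmetrizedState (B : ℝ) {M : ℕ} (n : Fin M → ℕ)
    (ψ : ∀ m : Fin M, Lp ℂ 2 (volume : Measure (Fin (n m) → ℝ)))
    (x : Fin (∑ m, n m) → Space) : ℂ :=
  ((Real.sqrt (((∑ m, n m).factorial : ℝ) * ∏ m, ((n m).factorial : ℝ)))⁻¹ : ℝ) *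
    ∑ σ : Equiv.Perm (Fin (∑ m, n m)),
      ((Equiv.Perm.sign σ : ℤ) : ℂ) * productState B n ψ (fun i => x (σ i))

/-- `∑ m, ∫ ρ_m³`, where `ρ_m` is the one-dimensional density of `ψ_m`. -/
def sumCubes {M : ℕ} (n : Fin M → ℕ)
    (ψ : ∀ m : Fin M, Lp ℂ 2 (volume : Measure (Fin (n m) → ℝ))) : ℝ≥0∞ :=
  ∑ m : Fin M, ∫⁻ z : ℝ, density (fun y => ψ m y) z ^ 3

end LandauBand

end

/-!
The Coulomb potential is a superposition of products of Gaussians: up to a weight depending on `u`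
only, `1 / |x - y|` is the integral over `u > 0` and over the centres `s` of `h(x) h(y)`, where
`h` is the Gaussian of width `1 / u` centred at `s` (`coulomb_eq_lintegral`). Accordingly, twice the
Coulomb energy is a superposition of `P = ⟨Ψ | ∑_{i ≠ j} h(x_i) h(x_j) | Ψ⟩`, and twice the direct
energy one of the squares of `R = ⟨Ψ | ∑_i h(x_i) | Ψ⟩` (`two_mul_coulombEnergy`,
`two_mul_directEnergy`). So it is enough to bound `R ^ 2 - P`, integrated over `s`, for each `u`.
Two bounds are combined, one for `u ≤ U` and one for `u > U`.

* Long range. By the Cauchy-Schwarz inequality `R ^ 2 ≤ ⟨Ψ | (∑_i h(x_i)) ^ 2 | Ψ⟩`, so that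
  `R ^ 2 - P` is at most the self-interaction `⟨Ψ | ∑_i h(x_i) ^ 2 | Ψ⟩`. Weighted and integrated
  over `s`, this is `2 N / √π` for every `u` (`lintegral_oneExpect_sq_le`).

* Short range. By orthonormality of the orbitals, the only permutations that contribute to `P` are
  those that preserve the blocks, up to the exchange of one pair of particles. The former give
  direct terms; the latter are exchange terms, which are controlled by the matrix elements
  `o_{mm'} = ⟨φ_m | h | φ_m'⟩` of the transverse part of `h` (`abs_integral_pair_sub_le`). Particles
  in different blocks are independent along the axis, hence their direct terms cancel against those
  of `R ^ 2`, and there remains `R ^ 2 - P ≤ ∑_{m,m'} |o_{mm'}| ^ 2 r_m r_m'`, where `r_m` is the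
  integral of `ρ_m` against the axial part of `h` (`sq_one_body_le`). The sum over `m'` of
  `|o_{mm'}| ^ 2` is bounded by Bessel's inequality, or else by means of `∑_m |φ_m| ^ 2 ≤ B / 2π`,
  and Young's inequality bounds `∫ r_m ^ 2` by `∫ ρ_m ^ 2`. Weighted and integrated over `s`, the
  error is at most `Q (2 / u) min(1, B / 2u²)` with `Q = ∑_m ∫ ρ_m ^ 2`
  (`lintegral_oneExpect_sq_le_of_density`).

By the Cauchy-Schwarz inequality and `∑_m ∫ ρ_m = N` one has `Q ≤ √(N S)`. The choice `U = √(S / N)`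
makes the integrals over `u ≤ U` and `u > U` bounded by `√(N S)` times a constant and a logarithm,
respectively. The resulting inequality `directEnergy_le` has smaller constants than required.

The Coulomb energy is finite because `P ≤ 2 N R · sup_m ⟨φ_m | h | φ_m⟩`, and the supremum is
`O(u⁻²)` as `u → ∞`.
-/

noncomputable section

namespace LandauBand

open ComplexConjugate

/-! ### Permutations and antisymmetrization -/

section Permutations

variable {ι κ : Type*} [Fintype ι] [DecidableEq ι] [DecidableEq κ]

/-- Since `τ` preserves the cardinalities of the fibres of `b`, it cannot change the block of just
one point. -/
theorem comp_perm_eq_of_eq_off_singleton (b : ι → κ) (τ : Equiv.Perm ι) (i : ι)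
    (h : ∀ p, p ≠ i → b (τ p) = b p) (p : ι) : b (τ p) = b p := by
  by_cases hp : p = i
  · subst hp
    by_contra hne
    have key : ∑ q, (if b (τ q) = b p then (1 : ℕ) else 0) = ∑ q, if b q = b p then 1 else 0 :=
      Equiv.sum_comp τ fun q => if b q = b p then (1 : ℕ) else 0
    rw [← Finset.add_sum_erase _ _ (Finset.mem_univ p),
      ← Finset.add_sum_erase (f := fun q => if b q = b p then 1 else 0) _ (Finset.mem_univ p),
      Finset.sum_congr rfl (g := fun q => if b q = b p then 1 else 0)
        (fun q hq => by rw [h q (Finset.ne_of_mem_erase hq)])] at key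
    simp [hne] at key
  · exact h p hp

/-- A permutation that preserves all blocks except possibly at `i` and `j` either preserves these
too or exchanges them. -/
theorem comp_perm_eq_or_swapped_of_eq_off_pair (b : ι → κ) (τ : Equiv.Perm ι) {i j : ι}
    (hij : i ≠ j) (h : ∀ p, p ≠ i → p ≠ j → b (τ p) = b p) :
    (∀ p, b (τ p) = b p) ∨ (b i ≠ b j ∧ b (τ i) = b j ∧ b (τ j) = b i) := by
  have key : ∀ m, (if b (τ i) = m then (1 : ℕ) else 0) + (if b (τ j) = m then 1 else 0) =
      (if b i = m then 1 else 0) + (if b j = m then 1 else 0) := by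
    intro m
    have key : ∑ q, (if b (τ q) = m then (1 : ℕ) else 0) = ∑ q, if b q = m then 1 else 0 :=
      Equiv.sum_comp τ fun q => if b q = m then (1 : ℕ) else 0
    have hj : j ∈ Finset.univ.erase i := by simp [hij.symm]
    rw [← Finset.add_sum_erase _ _ (Finset.mem_univ i), ← Finset.add_sum_erase _ _ hj,
      ← Finset.add_sum_erase (f := fun q => if b q = m then 1 else 0) _ (Finset.mem_univ i),
      ← Finset.add_sum_erase (f := fun q => if b q = m then 1 else 0) _ hj,
      Finset.sum_congr rfl (g := fun q => if b q = m then 1 else 0)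
        (fun q hq => by
          rw [h q (Finset.ne_of_mem_erase (Finset.mem_of_mem_erase hq))
            (Finset.ne_of_mem_erase hq)])] at key
    omega
  by_cases hi : b (τ i) = b i
  · left
    exact comp_perm_eq_of_eq_off_singleton b τ j fun p hp => by
      by_cases hpi : p = i
      · rw [hpi, hi]
      · exact h p hpi hp
  · right
    have h1 := key (b i)
    have h2 := key (b j)
    have h3 := key (b (τ i))
    grind

end Permutations

section Antisymmetrization

theorem comp_perm_eq_piCongrLeft {ι X : Type*} [MeasurableSpace X] (σ : Equiv.Perm ι) :
    (fun (x : ι → X) i => x (σ i)) = MeasurableEquiv.piCongrLeft (fun _ : ι => X) σ⁻¹ := by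
  funext x i
  have := MeasurableEquiv.piCongrLeft_apply_apply (β := fun _ : ι => X) σ⁻¹ x (σ i)
  rw [show σ⁻¹ (σ i) = i from σ.symm_apply_apply i] at this
  exact this.symm

variable {ι : Type*} [Fintype ι] {X : Type*} [MeasureSpace X]
  [SigmaFinite (volume : Measure X)]

theorem measurePreserving_comp_perm (σ : Equiv.Perm ι) :
    MeasurePreserving (fun (x : ι → X) i => x (σ i)) := by
  rw [comp_perm_eq_piCongrLeft]
  exact volume_measurePreserving_piCongrLeft (fun _ : ι => X) σ⁻¹

theorem integral_comp_perm (σ : Equiv.Perm ι) {E : Type*} [NormedAddCommGroup E]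
    [NormedSpace ℝ E] (f : (ι → X) → E) :
    ∫ x : ι → X, f (fun i => x (σ i)) = ∫ x, f x := by
  have := volume_measurePreserving_piCongrLeft (fun _ : ι => X) σ⁻¹
  rw [← this.integral_comp' f, ← comp_perm_eq_piCongrLeft]

theorem integrable_conj_mul_perm {Φ : (ι → X) → ℂ} (hΦ : MemLp Φ 2) {K : (ι → X) → ℝ}
    (hKm : Measurable K) {C : ℝ} (hKb : ∀ x, |K x| ≤ C) (σ τ : Equiv.Perm ι) :
    Integrable fun x : ι → X => conj (Φ fun i => x (σ i)) * Φ (fun i => x (τ i)) * (K x : ℂ) := by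
  have h1 : MemLp (fun x : ι → X => conj (Φ fun i => x (σ i))) 2 :=
    (hΦ.comp_measurePreserving (measurePreserving_comp_perm σ)).star
  have h2 : MemLp (fun x : ι → X => Φ fun i => x (τ i)) 2 :=
    hΦ.comp_measurePreserving (measurePreserving_comp_perm τ)
  have h3 := h1.integrable_mul h2
  refine h3.mul_bdd (c := C) ?_ ?_
  · exact (Complex.measurable_ofReal.comp hKm).aestronglyMeasurable
  · exact Filter.Eventually.of_forall fun x => by simpa using hKb x

variable [DecidableEq ι]

/-- The total antisymmetrization of `Φ`, up to the constant `c`. -/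
def antisymmetrize (c : ℝ) (Φ : (ι → X) → ℂ) (x : ι → X) : ℂ :=
  (c : ℂ) * ∑ σ : Equiv.Perm ι, ((Equiv.Perm.sign σ : ℤ) : ℂ) * Φ (fun i => x (σ i))

/-- The expectation of a permutation-invariant observable in an antisymmetrized state reduces to a
single sum over permutations. -/
theorem integral_normSq_antisymmetrize (c : ℝ) {Φ : (ι → X) → ℂ} (hΦ : MemLp Φ 2)
    {K : (ι → X) → ℝ} (hKm : Measurable K) {C : ℝ} (hKb : ∀ x, |K x| ≤ C)
    (hKs : ∀ (σ : Equiv.Perm ι) x, K (fun i => x (σ i)) = K x) :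
    ((∫ x, ‖antisymmetrize c Φ x‖ ^ 2 * K x : ℝ) : ℂ) =
      c ^ 2 * (Fintype.card ι).factorial *
        ∑ τ : Equiv.Perm ι, ((Equiv.Perm.sign τ : ℤ) : ℂ) *
          ∫ x, conj (Φ x) * Φ (fun i => x (τ i)) * (K x : ℂ) := by
  have hexp : ∀ x, (((‖antisymmetrize c Φ x‖ ^ 2 * K x : ℝ)) : ℂ) =
      ∑ σ : Equiv.Perm ι, ∑ τ : Equiv.Perm ι, (c : ℂ) ^ 2 *
        (((Equiv.Perm.sign σ : ℤ) : ℂ) * ((Equiv.Perm.sign τ : ℤ) : ℂ)) *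
        (conj (Φ fun i => x (σ i)) * Φ (fun i => x (τ i)) * (K x : ℂ)) := by
    intro x
    push_cast
    rw [← Complex.conj_mul', antisymmetrize]
    simp only [map_mul, map_sum, Complex.conj_ofReal, map_intCast]
    rw [show ∀ a b d e f : ℂ, a * b * (d * e) * f = a * d * f * (b * e) by intros; ring,
      Finset.sum_mul_sum, Finset.mul_sum]
    refine Finset.sum_congr rfl fun σ _ => ?_
    rw [Finset.mul_sum]
    refine Finset.sum_congr rfl fun τ _ => ?_
    ring
  rw [← integral_complex_ofReal]
  simp_rw [hexp]
  rw [integral_finsetSum _ fun σ _ => integrable_finsetSum _ fun τ _ =>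
    (integrable_conj_mul_perm hΦ hKm hKb σ τ).const_mul _]
  have hterm : ∀ σ : Equiv.Perm ι, ∫ x : ι → X, ∑ τ : Equiv.Perm ι, (c : ℂ) ^ 2 *
        (((Equiv.Perm.sign σ : ℤ) : ℂ) * ((Equiv.Perm.sign τ : ℤ) : ℂ)) *
        (conj (Φ fun i => x (σ i)) * Φ (fun i => x (τ i)) * (K x : ℂ)) =
      (c : ℂ) ^ 2 * ∑ τ : Equiv.Perm ι, ((Equiv.Perm.sign τ : ℤ) : ℂ) *
          ∫ x, conj (Φ x) * Φ (fun i => x (τ i)) * (K x : ℂ) := by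
    intro σ
    rw [integral_finsetSum _ fun τ _ =>
      (integrable_conj_mul_perm hΦ hKm hKb σ τ).const_mul _, Finset.mul_sum,
      ← Equiv.sum_comp (Equiv.mulLeft σ)]
    refine Finset.sum_congr rfl fun τ _ => ?_
    rw [integral_const_mul, Equiv.coe_mulLeft, Equiv.Perm.sign_mul,
      ← integral_comp_perm σ (fun x => conj (Φ x) * Φ (fun i => x (τ i)) * (K x : ℂ))]
    simp only [hKs, Equiv.Perm.coe_mul, Function.comp_apply]
    have hs : ((Equiv.Perm.sign σ : ℤ) : ℂ) * ((Equiv.Perm.sign σ : ℤ) : ℂ) = 1 := by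
      rw [← Int.cast_mul, ← Units.val_mul, Int.units_mul_self]
      simp
    push_cast
    linear_combination (c : ℂ) ^ 2 * ((Equiv.Perm.sign τ : ℤ) : ℂ) *
      (∫ x : ι → X, conj (Φ fun i => x (σ i)) * Φ (fun i => x (σ (τ i))) * (K x : ℂ)) * hs
  simp_rw [hterm]
  rw [Finset.sum_const, Finset.card_univ, Fintype.card_perm, nsmul_eq_mul]
  ring

end Antisymmetrization

/-! ### Block states -/

section BlockState

variable {ι κ : Type*} [Fintype ι] [DecidableEq ι]

/-- The state in which particle `p` occupies the transverse orbital `φ (b p)`, while the axial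
coordinates are described by the joint wave function `F`. -/
def blockProduct (b : ι → κ) (φ : κ → ℂ → ℂ) (F : (ι → ℝ) → ℂ) (x : ι → Space) : ℂ :=
  F (fun p => (x p).2) * ∏ p, φ (b p) (x p).1

/-- The matrix element `⟨φ_m | g | φ_m'⟩` of multiplication by `g`. -/
def overlap (φ : κ → ℂ → ℂ) (g : ℂ → ℝ) (m m' : κ) : ℂ :=
  ∫ w, conj (φ m w) * φ m' w * (g w : ℂ)

/-- The expectation of `∏ p ∈ A, g (z p)` in the axial wave function `F`. -/
def axialWeight (F : (ι → ℝ) → ℂ) (g : ℝ → ℝ) (A : Finset ι) : ℝ :=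
  ∫ z, ‖F z‖ ^ 2 * ∏ p ∈ A, g (z p)

/-- The standing assumptions on a block state: the orbitals are orthonormal, and `F` is normalized
and antisymmetric under the permutations that preserve the blocks. -/
structure IsBlockState [DecidableEq κ] (b : ι → κ) (φ : κ → ℂ → ℂ) (F : (ι → ℝ) → ℂ) : Prop where
  measurable_orbital : ∀ m, Measurable (φ m)
  orthonormal : ∀ m m', ∫ w, conj (φ m w) * φ m' w = if m = m' then 1 else 0
  measurable_axial : Measurable F
  norm_axial : ∫ z, ‖F z‖ ^ 2 = 1
  antisymm : ∀ τ : Equiv.Perm ι, (∀ p, b (τ p) = b p) →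
    ∀ᵐ z : ι → ℝ, F (fun i => z (τ i)) = ((Equiv.Perm.sign τ : ℤ) : ℂ) * F z

theorem overlap_conj (φ : κ → ℂ → ℂ) (g : ℂ → ℝ) (m m' : κ) :
    overlap φ g m' m = conj (overlap φ g m m') := by
  rw [overlap, overlap, ← integral_conj]
  congr 1
  ext w
  simp only [map_mul, Complex.conj_conj, Complex.conj_ofReal]
  ring

theorem overlap_self_eq (φ : κ → ℂ → ℂ) (g : ℂ → ℝ) (m : κ) :
    overlap φ g m m = ((∫ w, ‖φ m w‖ ^ 2 * g w : ℝ) : ℂ) := by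
  rw [overlap, ← integral_complex_ofReal]
  congr 1
  ext w
  rw [Complex.conj_mul']
  push_cast
  rfl

variable [DecidableEq κ] {b : ι → κ} {φ : κ → ℂ → ℂ} {F : (ι → ℝ) → ℂ}

namespace IsBlockState

theorem integrable_axial (h : IsBlockState b φ F) : Integrable fun z => ‖F z‖ ^ 2 := by
  by_contra hn
  have := h.norm_axial
  rw [integral_undef hn] at this
  exact zero_ne_one this

theorem integrable_orbital (h : IsBlockState b φ F) (m : κ) :
    Integrable fun w => ‖φ m w‖ ^ 2 := by
  by_contra hn
  have h1 : overlap φ 1 m m = 1 := by simp [overlap, h.orthonormal]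
  rw [overlap_self_eq] at h1
  simp only [Pi.one_apply, mul_one] at h1
  rw [integral_undef hn] at h1
  simp at h1

theorem memLp_blockProduct (h : IsBlockState b φ F) : MemLp (blockProduct b φ F) 2 := by
  have hm : Measurable (blockProduct b φ F) := by
    refine (h.measurable_axial.comp (by fun_prop)).mul ?_
    exact Finset.measurable_prod _ fun p _ => (h.measurable_orbital _).comp (by fun_prop)
  rw [memLp_two_iff_integrable_sq_norm hm.aestronglyMeasurable]
  have h1 : Integrable fun y : (ι → ℂ) × (ι → ℝ) =>
      (∏ p, ‖φ (b p) (y.1 p)‖ ^ 2) * ‖F y.2‖ ^ 2 := by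
    refine Integrable.mul_prod (f := fun w : ι → ℂ => ∏ p, ‖φ (b p) (w p)‖ ^ 2)
      (g := fun z => ‖F z‖ ^ 2) ?_ h.integrable_axial
    exact Integrable.fintype_prod fun p => h.integrable_orbital (b p)
  have h2 := ((volume_measurePreserving_arrowProdEquivProdArrow ℂ ℝ ι).integrable_comp_emb
    (MeasurableEquiv.measurableEmbedding _)).2 h1
  refine h2.congr (Filter.Eventually.of_forall fun x => ?_)
  simp only [blockProduct, norm_mul, norm_prod, mul_pow, Finset.prod_pow, Function.comp]
  rw [mul_comm]
  rfl

/-- The matrix elements of `∏ p ∈ A, g₁ (w p) * g₂ (z p)` between a block state and its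
permutations factorize over the particles in the transverse variables. -/
theorem integral_conj_mul_perm (h : IsBlockState b φ F) (g₁ : ℂ → ℝ) (g₂ : ℝ → ℝ) (A : Finset ι)
    (τ : Equiv.Perm ι) :
    ∫ x, conj (blockProduct b φ F x) * blockProduct b φ F (fun i => x (τ i)) *
        ((∏ p ∈ A, g₁ (x p).1 * g₂ (x p).2 : ℝ) : ℂ) =
      (∏ p, if p ∈ A then overlap φ g₁ (b p) (b (τ.symm p))
        else if b p = b (τ.symm p) then 1 else 0) *
      ∫ z, conj (F z) * F (fun i => z (τ i)) * ((∏ p ∈ A, g₂ (z p) : ℝ) : ℂ) := by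
  have hf : ∀ x : ι → Space, conj (blockProduct b φ F x) * blockProduct b φ F (fun i => x (τ i)) *
        ((∏ p ∈ A, g₁ (x p).1 * g₂ (x p).2 : ℝ) : ℂ) =
      (fun y : (ι → ℂ) × (ι → ℝ) => (∏ p, conj (φ (b p) (y.1 p)) * φ (b (τ.symm p)) (y.1 p) *
          (if p ∈ A then (g₁ (y.1 p) : ℂ) else 1)) *
        (conj (F y.2) * F (fun i => y.2 (τ i)) * ((∏ p ∈ A, g₂ (y.2 p) : ℝ) : ℂ)))
      (MeasurableEquiv.arrowProdEquivProdArrow ℂ ℝ ι x) := by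
    intro x
    have hτ : ∏ p, φ (b p) (x (τ p)).1 = ∏ p, φ (b (τ.symm p)) (x p).1 := by
      simpa using Equiv.prod_comp τ fun p => φ (b (τ.symm p)) (x p).1
    simp only [blockProduct, map_mul, map_prod, hτ, MeasurableEquiv.arrowProdEquivProdArrow,
      Equiv.arrowProdEquivProdArrow, MeasurableEquiv.coe_mk, Equiv.coe_fn_mk,
      Finset.prod_mul_distrib, Finset.prod_ite_mem, Finset.univ_inter, Complex.ofReal_mul,
      Complex.ofReal_prod]
    ring
  rw [integral_congr_ae (ae_of_all _ hf),
    (volume_measurePreserving_arrowProdEquivProdArrow ℂ ℝ ι).integral_comp'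
    (fun y : (ι → ℂ) × (ι → ℝ) => (∏ p, conj (φ (b p) (y.1 p)) * φ (b (τ.symm p)) (y.1 p) *
          (if p ∈ A then (g₁ (y.1 p) : ℂ) else 1)) *
        (conj (F y.2) * F (fun i => y.2 (τ i)) * ((∏ p ∈ A, g₂ (y.2 p) : ℝ) : ℂ)))]
  rw [Measure.volume_eq_prod, integral_prod_mul (fun w : ι → ℂ => ∏ p, conj (φ (b p) (w p)) *
    φ (b (τ.symm p)) (w p) * (if p ∈ A then (g₁ (w p) : ℂ) else 1))
    (fun z : ι → ℝ => conj (F z) * F (fun i => z (τ i)) * ((∏ p ∈ A, g₂ (z p) : ℝ) : ℂ))]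
  rw [integral_fintype_prod_volume_eq_prod (fun p w => conj (φ (b p) w) *
    φ (b (τ.symm p)) w * (if p ∈ A then (g₁ w : ℂ) else 1))]
  congr 1
  refine Finset.prod_congr rfl fun p _ => ?_
  split_ifs with hA hb
  · rfl
  · simp [h.orthonormal, hb]
  · simp [h.orthonormal, hb]

/-- A permutation preserving the blocks contributes the direct term. -/
theorem integral_conj_mul_perm_of_stab (h : IsBlockState b φ F) (g₁ : ℂ → ℝ) (g₂ : ℝ → ℝ)
    (A : Finset ι) (τ : Equiv.Perm ι) (hτ : ∀ p, b (τ p) = b p) :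
    ((Equiv.Perm.sign τ : ℤ) : ℂ) * ∫ x, conj (blockProduct b φ F x) *
        blockProduct b φ F (fun i => x (τ i)) * ((∏ p ∈ A, g₁ (x p).1 * g₂ (x p).2 : ℝ) : ℂ) =
      (∏ p ∈ A, overlap φ g₁ (b p) (b p)) * (axialWeight F g₂ A : ℂ) := by
  have hsymm : ∀ p, b (τ.symm p) = b p := fun p => by
    rw [← hτ (τ.symm p), Equiv.apply_symm_apply]
  rw [h.integral_conj_mul_perm, mul_left_comm]
  congr 1
  · simp [hsymm, Finset.prod_ite_mem]
  · rw [axialWeight, ← integral_complex_ofReal, ← integral_const_mul]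
    refine integral_congr_ae ?_
    filter_upwards [h.antisymm τ hτ] with z hz
    have hs : ((Equiv.Perm.sign τ : ℤ) : ℂ) * ((Equiv.Perm.sign τ : ℤ) : ℂ) = 1 := by
      rw [← Int.cast_mul, ← Units.val_mul, Int.units_mul_self]
      simp
    rw [hz, Complex.ofReal_mul, Complex.ofReal_pow, ← Complex.conj_mul']
    linear_combination conj (F z) * F z * ((∏ p ∈ A, g₂ (z p) : ℝ) : ℂ) * hs

/-- By orthogonality of the orbitals, a permutation that moves a particle on which the observable
does not act to another block does not contribute. -/
theorem integral_conj_mul_perm_eq_zero (h : IsBlockState b φ F) (g₁ : ℂ → ℝ) (g₂ : ℝ → ℝ)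
    (A : Finset ι) (τ : Equiv.Perm ι) {p : ι} (hp : p ∉ A) (hτ : b (τ.symm p) ≠ b p) :
    ∫ x, conj (blockProduct b φ F x) * blockProduct b φ F (fun i => x (τ i)) *
      ((∏ p ∈ A, g₁ (x p).1 * g₂ (x p).2 : ℝ) : ℂ) = 0 := by
  rw [h.integral_conj_mul_perm, Finset.prod_eq_zero (Finset.mem_univ p), zero_mul]
  simp [hp, hτ.symm]

theorem integrable_axial_mul (h : IsBlockState b φ F) {g : ℝ → ℝ} (hg : Measurable g)
    (hg0 : ∀ z, 0 ≤ g z) (hg1 : ∀ z, g z ≤ 1) (A : Finset ι) :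
    Integrable fun z => ‖F z‖ ^ 2 * ∏ p ∈ A, g (z p) := by
  refine h.integrable_axial.mul_bdd (c := 1) ?_ ?_
  · exact (Finset.measurable_prod A fun p _ =>
      hg.comp (measurable_pi_apply p)).aestronglyMeasurable
  · refine Filter.Eventually.of_forall fun z => ?_
    rw [Real.norm_eq_abs, abs_of_nonneg (Finset.prod_nonneg fun p _ => hg0 _)]
    exact Finset.prod_le_one (fun p _ => hg0 _) fun p _ => hg1 _

/-- A permutation that preserves the blocks up to the exchange of those of `i` and `j` contributes
at most an exchange term. The axial factor is bounded by AM-GM: up to a sign, the permuted `F` is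
`F` with `z i` and `z j` exchanged, and the observable is symmetric in these. -/
theorem norm_integral_conj_mul_perm_le (h : IsBlockState b φ F) {g₁ : ℂ → ℝ} {g₂ : ℝ → ℝ}
    (hg : Measurable g₂) (hg0 : ∀ z, 0 ≤ g₂ z) (hg1 : ∀ z, g₂ z ≤ 1) {i j : ι} (hij : i ≠ j)
    (τ : Equiv.Perm ι) (hi : b (τ.symm i) = b j) (hj : b (τ.symm j) = b i)
    (hτ : ∀ p, p ≠ i → p ≠ j → b (τ.symm p) = b p) :
    ‖∫ x, conj (blockProduct b φ F x) * blockProduct b φ F (fun k => x (τ k)) *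
      ((∏ p ∈ {i, j}, g₁ (x p).1 * g₂ (x p).2 : ℝ) : ℂ)‖ ≤
      ‖overlap φ g₁ (b i) (b j)‖ ^ 2 * axialWeight F g₂ {i, j} := by
  set s : Equiv.Perm ι := Equiv.swap i j with hs
  have hη : ∀ p, b ((s * τ) p) = b p := by
    intro p
    obtain ⟨q, rfl⟩ := τ.symm.surjective p
    rw [Equiv.Perm.mul_apply, Equiv.apply_symm_apply]
    by_cases hqi : q = i
    · rw [hqi, hs, Equiv.swap_apply_left, hi]
    by_cases hqj : q = j
    · rw [hqj, hs, Equiv.swap_apply_right, hj]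
    · rw [hs, Equiv.swap_apply_of_ne_of_ne hqi hqj, hτ q hqi hqj]
  have hFτ : ∀ᵐ z : ι → ℝ, ‖F fun k => z (τ k)‖ = ‖F fun k => z (s k)‖ := by
    have := (measurePreserving_comp_perm (X := ℝ) s).quasiMeasurePreserving.ae (h.antisymm _ hη)
    filter_upwards [this] with z hz
    have h1 : (fun k => z (s ((s * τ) k))) = fun k => z (τ k) := by
      funext k
      rw [Equiv.Perm.mul_apply, hs, Equiv.swap_apply_self]
    rw [h1] at hz
    rw [hz, norm_mul]
    rcases Int.units_eq_one_or (Equiv.Perm.sign (s * τ)) with h2 | h2 <;> simp [h2]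
  have hq0 : ∀ z : ι → ℝ, 0 ≤ ∏ p ∈ {i, j}, g₂ (z p) := fun z =>
    Finset.prod_nonneg fun p _ => hg0 _
  have hsw : ∀ z : ι → ℝ, ∏ p ∈ {i, j}, g₂ (z (s p)) = ∏ p ∈ {i, j}, g₂ (z p) := by
    intro z
    rw [Finset.prod_pair hij, Finset.prod_pair hij, hs, Equiv.swap_apply_left,
      Equiv.swap_apply_right, mul_comm]
  have hint := h.integrable_axial_mul hg hg0 hg1 {i, j}
  have hint' : Integrable fun z : ι → ℝ => ‖F fun k => z (s k)‖ ^ 2 * ∏ p ∈ {i, j}, g₂ (z p) := by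
    have := (measurePreserving_comp_perm (X := ℝ) s).integrable_comp_of_integrable hint
    simpa only [Function.comp_def, hsw] using this
  have heq : ∫ z : ι → ℝ, ‖F fun k => z (s k)‖ ^ 2 * ∏ p ∈ {i, j}, g₂ (z p) =
      axialWeight F g₂ {i, j} := by
    have := integral_comp_perm s fun z : ι → ℝ => ‖F z‖ ^ 2 * ∏ p ∈ {i, j}, g₂ (z p)
    simp only [hsw] at this
    exact this
  have hz : ‖∫ z, conj (F z) * F (fun k => z (τ k)) * ((∏ p ∈ {i, j}, g₂ (z p) : ℝ) : ℂ)‖ ≤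
      axialWeight F g₂ {i, j} := by
    calc _ ≤ ∫ z : ι → ℝ, (1 / 2) * (‖F z‖ ^ 2 * ∏ p ∈ {i, j}, g₂ (z p)) +
        (1 / 2) * (‖F fun k => z (s k)‖ ^ 2 * ∏ p ∈ {i, j}, g₂ (z p)) := by
          refine norm_integral_le_of_norm_le ((hint.const_mul _).add (hint'.const_mul _)) ?_
          filter_upwards [hFτ] with z hz
          rw [norm_mul, norm_mul, hz, RCLike.norm_conj, Complex.norm_real, Real.norm_eq_abs,
            abs_of_nonneg (hq0 z)]
          nlinarith [mul_nonneg (sq_nonneg (‖F z‖ - ‖F fun k => z (s k)‖)) (hq0 z)]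
      _ = axialWeight F g₂ {i, j} := by
          rw [integral_add (hint.const_mul _) (hint'.const_mul _), integral_const_mul,
            integral_const_mul, heq, axialWeight]
          ring
  rw [h.integral_conj_mul_perm, norm_mul, norm_prod]
  refine mul_le_mul (le_of_eq ?_) hz (norm_nonneg _) (sq_nonneg _)
  have hj' : j ∈ Finset.univ.erase i := by simp [hij.symm]
  rw [← Finset.mul_prod_erase _ _ (Finset.mem_univ i), ← Finset.mul_prod_erase _ _ hj',
    Finset.prod_eq_one, if_pos (by simp), if_pos (by simp), hi, hj,
    overlap_conj φ g₁ (b i) (b j), RCLike.norm_conj]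
  · ring
  · intro p hp
    have hpj := Finset.ne_of_mem_erase hp
    have hpi := Finset.ne_of_mem_erase (Finset.mem_of_mem_erase hp)
    simp [hpi, hpj, hτ p hpi hpj]

end IsBlockState

end BlockState

/-! ### Sums over permutations -/

section Expectation

theorem symm_comp_of_comp {ι κ : Type*} {b : ι → κ} {τ : Equiv.Perm ι}
    (h : ∀ p, b (τ.symm p) = b p) (p : ι) : b (τ p) = b p := by
  rw [← h (τ p), Equiv.symm_apply_apply]

variable {ι κ : Type*} [Fintype ι] [DecidableEq ι] [DecidableEq κ]

/-- The permutations that preserve the blocks. -/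
def blockPerms (b : ι → κ) : Finset (Equiv.Perm ι) :=
  Finset.univ.filter fun τ => ∀ p, b (τ p) = b p

/-- The sum over all permutations of the signed matrix elements of `∏ p ∈ A, g₁ (w p) * g₂ (z p)`.
-/
def permSum (b : ι → κ) (φ : κ → ℂ → ℂ) (F : (ι → ℝ) → ℂ) (g₁ : ℂ → ℝ) (g₂ : ℝ → ℝ)
    (A : Finset ι) : ℂ :=
  ∑ τ : Equiv.Perm ι, ((Equiv.Perm.sign τ : ℤ) : ℂ) *
    ∫ x, conj (blockProduct b φ F x) * blockProduct b φ F (fun i => x (τ i)) *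
      ((∏ p ∈ A, g₁ (x p).1 * g₂ (x p).2 : ℝ) : ℂ)

theorem sum_blockPerms (b : ι → κ) {φ : κ → ℂ → ℂ} {F : (ι → ℝ) → ℂ} (h : IsBlockState b φ F)
    (g₁ : ℂ → ℝ) (g₂ : ℝ → ℝ) (A : Finset ι) :
    ∑ τ ∈ blockPerms b, ((Equiv.Perm.sign τ : ℤ) : ℂ) *
      ∫ x, conj (blockProduct b φ F x) * blockProduct b φ F (fun i => x (τ i)) *
        ((∏ p ∈ A, g₁ (x p).1 * g₂ (x p).2 : ℝ) : ℂ) =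
    (blockPerms b).card * ((∏ p ∈ A, overlap φ g₁ (b p) (b p)) * (axialWeight F g₂ A : ℂ)) := by
  rw [Finset.sum_congr (s₂ := blockPerms b) rfl fun τ hτ =>
    h.integral_conj_mul_perm_of_stab g₁ g₂ A τ (Finset.mem_filter.1 hτ).2,
    Finset.sum_const, nsmul_eq_mul]

/-- For observables of at most one particle, only the permutations preserving the blocks
contribute. -/
theorem permSum_of_card_le_one {b : ι → κ} {φ : κ → ℂ → ℂ} {F : (ι → ℝ) → ℂ}
    (h : IsBlockState b φ F) (g₁ : ℂ → ℝ) (g₂ : ℝ → ℝ) {A : Finset ι}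
    (hA : A.card ≤ 1) :
    permSum b φ F g₁ g₂ A = (blockPerms b).card *
      ((∏ p ∈ A, overlap φ g₁ (b p) (b p)) * (axialWeight F g₂ A : ℂ)) := by
  rw [← sum_blockPerms b h, permSum]
  symm
  refine Finset.sum_subset (Finset.subset_univ _) fun τ _ hτ => ?_
  obtain ⟨p, hpA, hp⟩ : ∃ p, p ∉ A ∧ b (τ.symm p) ≠ b p := by
    by_contra! hc
    refine hτ (Finset.mem_filter.2 ⟨Finset.mem_univ _, symm_comp_of_comp ?_⟩)
    rcases A.eq_empty_or_nonempty with rfl | ⟨i, hi⟩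
    · exact fun p => hc p (by simp)
    · refine comp_perm_eq_of_eq_off_singleton b τ.symm i fun p hp => hc p fun hpA => hp ?_
      exact Finset.card_le_one.1 hA p hpA i hi
  rw [h.integral_conj_mul_perm_eq_zero g₁ g₂ A τ hpA hp, mul_zero]

/-- For an observable of the pair `i`, `j`, the sum over permutations is the direct term up to an
exchange term, which occurs only if `i` and `j` belong to different blocks. -/
theorem norm_permSum_pair_sub_le {b : ι → κ} {φ : κ → ℂ → ℂ} {F : (ι → ℝ) → ℂ}
    (h : IsBlockState b φ F) (g₁ : ℂ → ℝ) {g₂ : ℝ → ℝ}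
    (hg : Measurable g₂) (hg0 : ∀ z, 0 ≤ g₂ z) (hg1 : ∀ z, g₂ z ≤ 1) {i j : ι} (hij : i ≠ j) :
    ‖permSum b φ F g₁ g₂ {i, j} - (blockPerms b).card *
      (overlap φ g₁ (b i) (b i) * overlap φ g₁ (b j) (b j) * (axialWeight F g₂ {i, j} : ℂ))‖ ≤
    if b i = b j then 0 else
      (blockPerms b).card * (‖overlap φ g₁ (b i) (b j)‖ ^ 2 * axialWeight F g₂ {i, j}) := by
  have h0 := sum_blockPerms b h g₁ g₂ {i, j}
  rw [Finset.prod_pair hij] at h0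
  rw [← h0, permSum,
    ← Finset.sum_filter_add_sum_filter_not Finset.univ (fun τ => ∀ p, b (τ p) = b p),
    ← blockPerms, add_sub_cancel_left]
  -- The permutations outside `blockPerms b` that contribute exchange the blocks of `i` and `j`.
  set S : Finset (Equiv.Perm ι) := Finset.univ.filter fun τ => b i ≠ b j ∧ b (τ.symm i) = b j ∧
    b (τ.symm j) = b i ∧ ∀ p, p ≠ i → p ≠ j → b (τ.symm p) = b p with hS
  have hsub : S ⊆ Finset.univ.filter fun τ => ¬ ∀ p, b (τ p) = b p := by
    intro τ hτ
    simp only [hS, Finset.mem_filter, Finset.mem_univ, true_and] at hτ ⊢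
    intro hc
    have := hc (τ.symm i)
    rw [Equiv.apply_symm_apply] at this
    exact hτ.1 (this.trans hτ.2.1)
  rw [← Finset.sum_subset hsub]
  · split_ifs with hb
    · rw [Finset.sum_eq_zero, norm_zero]
      intro τ hτ
      simp only [hS, Finset.mem_filter, Finset.mem_univ, true_and] at hτ
      exact absurd hb hτ.1
    · have hcard : S.card ≤ (blockPerms b).card := by
        refine Finset.card_le_card_of_injOn (fun τ => Equiv.swap i j * τ) ?_
          (fun τ _ τ' _ hττ => mul_left_cancel hττ)
        intro τ hτ
        simp only [hS, Finset.coe_filter, Finset.mem_univ, true_and, Set.mem_ofPred_eq] at hτ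
        simp only [blockPerms, Finset.coe_filter, Finset.mem_univ, true_and, Set.mem_ofPred_eq]
        intro p
        obtain ⟨q, rfl⟩ := τ.symm.surjective p
        rw [Equiv.Perm.mul_apply, Equiv.apply_symm_apply]
        by_cases hqi : q = i
        · rw [hqi, Equiv.swap_apply_left, hτ.2.1]
        by_cases hqj : q = j
        · rw [hqj, Equiv.swap_apply_right, hτ.2.2.1]
        · rw [Equiv.swap_apply_of_ne_of_ne hqi hqj, hτ.2.2.2 q hqi hqj]
      have hq : 0 ≤ axialWeight F g₂ {i, j} := integral_nonneg fun z =>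
        mul_nonneg (sq_nonneg _) (Finset.prod_nonneg fun p _ => hg0 _)
      refine (norm_sum_le_of_le S (n := fun _ =>
        ‖overlap φ g₁ (b i) (b j)‖ ^ 2 * axialWeight F g₂ {i, j}) fun τ hτ => ?_).trans ?_
      · simp only [hS, Finset.mem_filter, Finset.mem_univ, true_and] at hτ
        have := h.norm_integral_conj_mul_perm_le (g₁ := g₁) hg hg0 hg1 hij τ hτ.2.1 hτ.2.2.1
          hτ.2.2.2
        rw [norm_mul]
        rcases Int.units_eq_one_or (Equiv.Perm.sign τ) with h2 | h2 <;> simpa [h2] using this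
      · rw [Finset.sum_const, nsmul_eq_mul]
        have : (S.card : ℝ) ≤ (blockPerms b).card := by exact_mod_cast hcard
        gcongr
  · intro τ hτ hτS
    obtain ⟨p, hpA, hp⟩ : ∃ p, p ∉ ({i, j} : Finset ι) ∧ b (τ.symm p) ≠ b p := by
      by_contra! hc
      have hc' : ∀ p, p ≠ i → p ≠ j → b (τ.symm p) = b p := fun p hi hj => hc p (by simp [hi, hj])
      rcases comp_perm_eq_or_swapped_of_eq_off_pair b τ.symm hij hc' with h1 | h1
      · exact (Finset.mem_filter.1 hτ).2 (symm_comp_of_comp h1)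
      · exact hτS (Finset.mem_filter.2 ⟨Finset.mem_univ _, h1.1, h1.2.1, h1.2.2, hc'⟩)
    rw [h.integral_conj_mul_perm_eq_zero g₁ g₂ _ τ hpA hp, mul_zero]

/-- Expectation values of sums of products of one-particle observables in the antisymmetrized block
state. -/
theorem integral_normSq_antisymmetrize_sum {b : ι → κ} {φ : κ → ℂ → ℂ} {F : (ι → ℝ) → ℂ}
    (h : IsBlockState b φ F) (c : ℝ) {g₁ : ℂ → ℝ} {g₂ : ℝ → ℝ} (hg₁ : Measurable g₁)
    (hg₁0 : ∀ w, 0 ≤ g₁ w) (hg₁1 : ∀ w, g₁ w ≤ 1)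
    (hg : Measurable g₂) (hg0 : ∀ z, 0 ≤ g₂ z) (hg1 : ∀ z, g₂ z ≤ 1) {α : Type*}
    (T : Finset α) (A : α → Finset ι)
    (hT : ∀ (σ : Equiv.Perm ι) (x : ι → Space),
      ∑ a ∈ T, ∏ p ∈ A a, g₁ (x (σ p)).1 * g₂ (x (σ p)).2 =
      ∑ a ∈ T, ∏ p ∈ A a, g₁ (x p).1 * g₂ (x p).2) :
    ((∫ x, ‖antisymmetrize c (blockProduct b φ F) x‖ ^ 2 *
        ∑ a ∈ T, ∏ p ∈ A a, g₁ (x p).1 * g₂ (x p).2 : ℝ) : ℂ) =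
      c ^ 2 * (Fintype.card ι).factorial * ∑ a ∈ T, permSum b φ F g₁ g₂ (A a) := by
  have hm : ∀ A : Finset ι, Measurable fun x : ι → Space => ∏ p ∈ A, g₁ (x p).1 * g₂ (x p).2 :=
    fun A => Finset.measurable_prod _ fun p _ =>
      (hg₁.comp (by fun_prop)).mul (hg.comp (by fun_prop))
  have hb0 : ∀ (A : Finset ι) (x : ι → Space), 0 ≤ ∏ p ∈ A, g₁ (x p).1 * g₂ (x p).2 :=
    fun A x => Finset.prod_nonneg fun p _ => mul_nonneg (hg₁0 _) (hg0 _)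
  have hb1 : ∀ (A : Finset ι) (x : ι → Space), ∏ p ∈ A, g₁ (x p).1 * g₂ (x p).2 ≤ 1 :=
    fun A x => Finset.prod_le_one (fun p _ => mul_nonneg (hg₁0 _) (hg0 _))
      fun p _ => mul_le_one₀ (hg₁1 _) (hg0 _) (hg1 _)
  rw [integral_normSq_antisymmetrize c h.memLp_blockProduct
    (Finset.measurable_sum _ fun a _ => hm (A a)) (C := T.card) ?_ hT]
  · congr 1
    simp only [permSum]
    rw [Finset.sum_comm]
    refine Finset.sum_congr rfl fun τ _ => ?_
    rw [← Finset.mul_sum, ← integral_finsetSum]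
    · congr 2
      ext x
      rw [← Finset.mul_sum, Complex.ofReal_sum]
    · intro a _
      have := integrable_conj_mul_perm h.memLp_blockProduct (hm (A a)) (C := 1)
        (fun x => by rw [abs_of_nonneg (hb0 (A a) x)]; exact hb1 (A a) x) 1 τ
      simpa using this
  · intro x
    rw [abs_of_nonneg (Finset.sum_nonneg fun a _ => hb0 (A a) x)]
    calc _ ≤ ∑ _a ∈ T, (1 : ℝ) := Finset.sum_le_sum fun a _ => hb1 (A a) x
      _ = T.card := by simp

end Expectation

/-! ### Direct and exchange terms -/

section PairBounds

variable {ι κ : Type*} [Fintype ι]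

/-- The expectation of `g` in the transverse orbital `φ m`. -/
def orbitalWeight (φ : κ → ℂ → ℂ) (g : ℂ → ℝ) (m : κ) : ℝ :=
  ∫ w, ‖φ m w‖ ^ 2 * g w

variable {b : ι → κ} {φ : κ → ℂ → ℂ} {F : (ι → ℝ) → ℂ}

theorem orbitalWeight_nonneg {g : ℂ → ℝ} (hg0 : ∀ w, 0 ≤ g w) (m : κ) :
    0 ≤ orbitalWeight φ g m :=
  integral_nonneg fun w => mul_nonneg (sq_nonneg _) (hg0 w)

theorem axialWeight_nonneg {g : ℝ → ℝ} (hg0 : ∀ z, 0 ≤ g z) (A : Finset ι) :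
    0 ≤ axialWeight F g A :=
  integral_nonneg fun _ => mul_nonneg (sq_nonneg _) (Finset.prod_nonneg fun _ _ => hg0 _)

variable [DecidableEq ι] [DecidableEq κ]

namespace IsBlockState

variable (h : IsBlockState b φ F) {c : ℝ}
  (hc : c ^ 2 * (Fintype.card ι).factorial * (blockPerms b).card = 1)
  {g₁ : ℂ → ℝ} {g₂ : ℝ → ℝ} (hg₁ : Measurable g₁)
  (hg₁0 : ∀ w, 0 ≤ g₁ w) (hg₁1 : ∀ w, g₁ w ≤ 1)
  (hg : Measurable g₂) (hg0 : ∀ z, 0 ≤ g₂ z) (hg1 : ∀ z, g₂ z ≤ 1)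

include h hc

/-- The condition `hc` on the constant `c` is the normalization of the antisymmetrized state. -/
theorem norm_antisymmetrize :
    ∫ x, ‖antisymmetrize c (blockProduct b φ F) x‖ ^ 2 = 1 := by
  have := integral_normSq_antisymmetrize_sum h c (g₁ := fun _ => 1) (g₂ := fun _ => 1)
    measurable_const (by simp) (by simp) measurable_const (by simp) (by simp)
    ({()} : Finset Unit) (fun _ => ∅) (by simp)
  rw [Finset.sum_singleton, permSum_of_card_le_one h _ _ (by simp)] at this
  simp only [axialWeight, Finset.prod_empty, Finset.sum_singleton, mul_one, h.norm_axial,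
    Complex.ofReal_one] at this
  have hc' : (c : ℂ) ^ 2 * (Fintype.card ι).factorial * (blockPerms b).card = 1 := by
    exact_mod_cast hc
  rw [hc'] at this
  exact_mod_cast this

include hg₁ hg₁0 hg₁1 hg hg0 hg1

theorem integral_one_body :
    ∫ x, ‖antisymmetrize c (blockProduct b φ F) x‖ ^ 2 * ∑ i, g₁ (x i).1 * g₂ (x i).2 =
      ∑ i, orbitalWeight φ g₁ (b i) * axialWeight F g₂ {i} := by
  have := integral_normSq_antisymmetrize_sum h c hg₁ hg₁0 hg₁1 hg hg0 hg1 Finset.univ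
    (fun i : ι => {i}) (fun σ x => by
      simpa using Equiv.sum_comp σ fun i => g₁ (x i).1 * g₂ (x i).2)
  simp_rw [permSum_of_card_le_one h _ _ (Finset.card_singleton _).le] at this
  simp only [Finset.prod_singleton, overlap_self_eq] at this
  have hc' : (c : ℂ) ^ 2 * (Fintype.card ι).factorial * (blockPerms b).card = 1 := by
    exact_mod_cast hc
  rw [← Finset.mul_sum, ← mul_assoc, hc', one_mul] at this
  exact_mod_cast this

/-- The pair expectation is the sum of the direct terms up to exchange terms between different
blocks. -/
theorem abs_integral_pair_sub_le :
    |(∫ x, ‖antisymmetrize c (blockProduct b φ F) x‖ ^ 2 *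
        ∑ q ∈ (Finset.univ : Finset ι).offDiag,
          (g₁ (x q.1).1 * g₂ (x q.1).2) * (g₁ (x q.2).1 * g₂ (x q.2).2)) -
      ∑ q ∈ (Finset.univ : Finset ι).offDiag,
        orbitalWeight φ g₁ (b q.1) * orbitalWeight φ g₁ (b q.2) * axialWeight F g₂ {q.1, q.2}| ≤
    ∑ q ∈ (Finset.univ : Finset ι).offDiag, if b q.1 = b q.2 then 0 else
      ‖overlap φ g₁ (b q.1) (b q.2)‖ ^ 2 * axialWeight F g₂ {q.1, q.2} := by
  have hprod : ∀ x : ι → Space, ∑ q ∈ (Finset.univ : Finset ι).offDiag,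
      ∏ p ∈ {q.1, q.2}, g₁ (x p).1 * g₂ (x p).2 = ∑ q ∈ (Finset.univ : Finset ι).offDiag,
      (g₁ (x q.1).1 * g₂ (x q.1).2) * (g₁ (x q.2).1 * g₂ (x q.2).2) := fun x =>
    Finset.sum_congr rfl fun q hq => Finset.prod_pair (Finset.mem_offDiag.1 hq).2.2
  have := integral_normSq_antisymmetrize_sum h c hg₁ hg₁0 hg₁1 hg hg0 hg1
    (Finset.univ : Finset ι).offDiag (fun q : ι × ι => {q.1, q.2}) (fun σ x => by
      refine Finset.sum_equiv (Equiv.prodCongr σ σ) (fun q => by simp) fun q hq => ?_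
      have hq' := (Finset.mem_offDiag.1 hq).2.2
      rw [Finset.prod_pair hq', Finset.prod_pair (by simpa using hq')]
      rfl)
  simp_rw [hprod] at this
  have hc' : (c : ℂ) ^ 2 * (Fintype.card ι).factorial * (blockPerms b).card = 1 := by
    exact_mod_cast hc
  set k : ℂ := (c : ℂ) ^ 2 * (Fintype.card ι).factorial with hk
  have hknorm : ‖k‖ * (blockPerms b).card = 1 := by
    have := congrArg norm hc'
    rwa [norm_mul, Complex.norm_natCast, norm_one] at this
  rw [← Real.norm_eq_abs, ← Complex.norm_real, Complex.ofReal_sub, this, Finset.mul_sum,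
    Complex.ofReal_sum, ← Finset.sum_sub_distrib]
  refine norm_sum_le_of_le _ fun q hq => ?_
  have hpair := norm_permSum_pair_sub_le h g₁ hg hg0 hg1 (Finset.mem_offDiag.1 hq).2.2
  have heq : k * permSum b φ F g₁ g₂ {q.1, q.2} - ((orbitalWeight φ g₁ (b q.1) *
      orbitalWeight φ g₁ (b q.2) * axialWeight F g₂ {q.1, q.2} : ℝ) : ℂ) =
      k * (permSum b φ F g₁ g₂ {q.1, q.2} - (blockPerms b).card *
        (overlap φ g₁ (b q.1) (b q.1) * overlap φ g₁ (b q.2) (b q.2) *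
          (axialWeight F g₂ {q.1, q.2} : ℂ))) := by
    rw [overlap_self_eq, overlap_self_eq, ← orbitalWeight, ← orbitalWeight]
    push_cast
    linear_combination ((orbitalWeight φ g₁ (b q.1) : ℂ) *
      orbitalWeight φ g₁ (b q.2) * axialWeight F g₂ {q.1, q.2}) * hc'
  rw [heq, norm_mul]
  refine (mul_le_mul_of_nonneg_left hpair (norm_nonneg _)).trans (le_of_eq ?_)
  split_ifs
  · simp
  · rw [← mul_assoc, hknorm, one_mul]

/-- The square of the mean of a one-particle observable exceeds the pair expectation at most by the
self-interaction of the blocks and the exchange terms. For particles in different blocks, the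
direct terms are the same on both sides by the independence `hind`; within a block, the pair
expectation is dropped, and the product of the means is itself of the form of an exchange term. -/
theorem sq_one_body_le
    (hind : ∀ i j, b i ≠ b j →
      axialWeight F g₂ {i, j} = axialWeight F g₂ {i} * axialWeight F g₂ {j}) :
    (∑ i, orbitalWeight φ g₁ (b i) * axialWeight F g₂ {i}) ^ 2 ≤
      (∫ x, ‖antisymmetrize c (blockProduct b φ F) x‖ ^ 2 *
        ∑ q ∈ (Finset.univ : Finset ι).offDiag,
          (g₁ (x q.1).1 * g₂ (x q.1).2) * (g₁ (x q.2).1 * g₂ (x q.2).2)) +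
      ∑ i, ∑ j, ‖overlap φ g₁ (b i) (b j)‖ ^ 2 *
        (axialWeight F g₂ {i} * axialWeight F g₂ {j}) := by
  have hpair := (abs_le.1 (h.abs_integral_pair_sub_le hc hg₁ hg₁0 hg₁1 hg hg0 hg1)).1
  have hkey : (∑ i, orbitalWeight φ g₁ (b i) * axialWeight F g₂ {i}) ^ 2 ≤
      ∑ q ∈ (Finset.univ : Finset ι).offDiag,
        orbitalWeight φ g₁ (b q.1) * orbitalWeight φ g₁ (b q.2) * axialWeight F g₂ {q.1, q.2} -
      (∑ q ∈ (Finset.univ : Finset ι).offDiag, if b q.1 = b q.2 then 0 else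
        ‖overlap φ g₁ (b q.1) (b q.2)‖ ^ 2 * axialWeight F g₂ {q.1, q.2}) +
      ∑ i, ∑ j, ‖overlap φ g₁ (b i) (b j)‖ ^ 2 *
        (axialWeight F g₂ {i} * axialWeight F g₂ {j}) := by
    have hsplit : ∀ f : ι × ι → ℝ, ∑ q, f q =
        ∑ q ∈ (Finset.univ : Finset ι).diag, f q + ∑ q ∈ (Finset.univ : Finset ι).offDiag, f q := by
      intro f
      rw [← Finset.univ_product_univ, ← Finset.diag_union_offDiag,
        Finset.sum_union (Finset.disjoint_diag_offDiag _)]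
    have hself : ∀ i j, b i = b j → orbitalWeight φ g₁ (b i) * orbitalWeight φ g₁ (b j) =
        ‖overlap φ g₁ (b i) (b j)‖ ^ 2 := by
      intro i j hij
      rw [← hij, overlap_self_eq, ← orbitalWeight, Complex.norm_real, Real.norm_eq_abs, sq_abs, sq]
    rw [sq, Finset.sum_mul_sum, ← Finset.sum_sub_distrib, ← Finset.sum_product',
      ← Finset.sum_product', Finset.univ_product_univ, hsplit, hsplit, ← add_assoc,
      add_comm (Finset.sum _ _) (Finset.sum (Finset.univ : Finset ι).diag _), add_assoc,
      ← Finset.sum_add_distrib]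
    refine add_le_add (Finset.sum_le_sum fun q hq => ?_) (Finset.sum_le_sum fun q hq => ?_)
    · have hq' : q.1 = q.2 := (Finset.mem_diag.1 hq).2
      rw [← hself q.1 q.2 (by rw [hq'])]
      exact le_of_eq (by ring)
    · have hq0 := axialWeight_nonneg (F := F) hg0 {q.1, q.2}
      have ha := orbitalWeight_nonneg (φ := φ) hg₁0
      split_ifs with hb
      · rw [← hself q.1 q.2 hb]
        nlinarith [mul_nonneg (mul_nonneg (ha (b q.1)) (ha (b q.2))) hq0]
      · rw [hind _ _ hb]
        exact le_of_eq (by ring)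
  linarith

/-- A bound on the pair expectation by direct terms only. -/
theorem integral_pair_le :
    (∫ x, ‖antisymmetrize c (blockProduct b φ F) x‖ ^ 2 *
        ∑ q ∈ (Finset.univ : Finset ι).offDiag,
          (g₁ (x q.1).1 * g₂ (x q.1).2) * (g₁ (x q.2).1 * g₂ (x q.2).2)) ≤
      ∑ q ∈ (Finset.univ : Finset ι).offDiag,
        (orbitalWeight φ g₁ (b q.1) ^ 2 + orbitalWeight φ g₁ (b q.2) ^ 2) *
          axialWeight F g₂ {q.1, q.2} := by
  have hpair := (abs_le.1 (h.abs_integral_pair_sub_le hc hg₁ hg₁0 hg₁1 hg hg0 hg1)).2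
  refine (sub_le_iff_le_add'.1 hpair).trans ?_
  rw [← Finset.sum_add_distrib]
  refine Finset.sum_le_sum fun q _ => ?_
  have hq := axialWeight_nonneg (F := F) hg0 {q.1, q.2}
  have ho : ‖overlap φ g₁ (b q.1) (b q.2)‖ ≤
      1 / 2 * orbitalWeight φ g₁ (b q.1) + 1 / 2 * orbitalWeight φ g₁ (b q.2) := by
    have hi : ∀ m, Integrable fun w => ‖φ m w‖ ^ 2 * g₁ w := fun m =>
      (h.integrable_orbital m).mul_bdd (c := 1) hg₁.aestronglyMeasurable
        (Filter.Eventually.of_forall fun w => by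
          rw [Real.norm_eq_abs, abs_of_nonneg (hg₁0 w)]; exact hg₁1 w)
    rw [orbitalWeight, orbitalWeight, ← integral_const_mul, ← integral_const_mul,
      ← integral_add ((hi _).const_mul _) ((hi _).const_mul _)]
    refine norm_integral_le_of_norm_le (((hi _).const_mul _).add ((hi _).const_mul _))
      (Filter.Eventually.of_forall fun w => ?_)
    rw [norm_mul, norm_mul, RCLike.norm_conj, Complex.norm_real, Real.norm_eq_abs,
      abs_of_nonneg (hg₁0 w)]
    nlinarith [mul_nonneg (sq_nonneg (‖φ (b q.1) w‖ - ‖φ (b q.2) w‖)) (hg₁0 w)]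
  have ho2 : ‖overlap φ g₁ (b q.1) (b q.2)‖ ^ 2 ≤
      (1 / 2 * orbitalWeight φ g₁ (b q.1) + 1 / 2 * orbitalWeight φ g₁ (b q.2)) ^ 2 :=
    pow_le_pow_left₀ (norm_nonneg _) ho 2
  have : (if b q.1 = b q.2 then 0 else
      ‖overlap φ g₁ (b q.1) (b q.2)‖ ^ 2 * axialWeight F g₂ {q.1, q.2}) ≤
      (1 / 2 * orbitalWeight φ g₁ (b q.1) + 1 / 2 * orbitalWeight φ g₁ (b q.2)) ^ 2 *
        axialWeight F g₂ {q.1, q.2} := by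
    split_ifs
    · positivity
    · gcongr
  refine (add_le_add_right this _).trans ?_
  rw [← add_mul]
  refine mul_le_mul_of_nonneg_right ?_ hq
  nlinarith [sq_nonneg (orbitalWeight φ g₁ (b q.1) - orbitalWeight φ g₁ (b q.2))]

end IsBlockState

end PairBounds

/-! ### Orbitals of the lowest Landau band -/

section Orbitals

/-- The radial factor of the orbital `φ_m` at distance `r` from the origin. -/
def phiRadial (B : ℝ) (m : ℕ) (r : ℝ) : ℝ :=
  Real.sqrt (B / (2 * Real.pi)) * (1 / Real.sqrt (m.factorial : ℝ)) *
    (B * r ^ 2 / 2) ^ ((m : ℝ) / 2) * Real.exp (-(B * r ^ 2) / 4)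

theorem phi_eq (B : ℝ) (m : ℕ) (w : ℂ) :
    phi B m w = (phiRadial B m ‖w‖ : ℂ) *
      Complex.exp (-(Complex.I * (m : ℂ) * (Complex.arg w : ℂ))) := rfl

theorem measurable_phi (B : ℝ) (m : ℕ) : Measurable (phi B m) := by
  unfold phi
  have h1 : Measurable fun w : ℂ => Complex.arg w := Complex.measurable_arg
  fun_prop

theorem norm_phi (B : ℝ) (m : ℕ) (w : ℂ) : ‖phi B m w‖ = |phiRadial B m ‖w‖| := by
  rw [phi_eq, norm_mul, Complex.norm_real, Real.norm_eq_abs, Complex.norm_exp]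
  simp

theorem norm_phi_sq {B : ℝ} (hB : 0 < B) (m : ℕ) (w : ℂ) :
    ‖phi B m w‖ ^ 2 = B / (2 * Real.pi) * ((B * ‖w‖ ^ 2 / 2) ^ m / m.factorial) *
      Real.exp (-(B * ‖w‖ ^ 2 / 2)) := by
  have hs : 0 ≤ B * ‖w‖ ^ 2 / 2 := by positivity
  rw [norm_phi, sq_abs, phiRadial, mul_pow, mul_pow, mul_pow, Real.sq_sqrt (by positivity),
    div_pow, Real.sq_sqrt (by positivity), ← Real.rpow_natCast (_ ^ ((m : ℝ) / 2)),
    ← Real.rpow_mul hs, ← Real.rpow_natCast _ m, ← Real.exp_nat_mul]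
  have h1 : (m : ℝ) / 2 * (2 : ℕ) = m := by push_cast; ring
  have h2 : ((2 : ℕ) : ℝ) * (-(B * ‖w‖ ^ 2) / 4) = -(B * ‖w‖ ^ 2 / 2) := by push_cast; ring
  rw [h1, h2]
  ring

/-- The orbitals `φ_0, …, φ_{M-1}` together have density at most `B / 2π`, since the `|φ_m(w)| ^ 2`
are `B / 2π` times Poisson weights. -/
theorem sum_norm_phi_sq_le {B : ℝ} (hB : 0 < B) (M : ℕ) (w : ℂ) :
    ∑ m : Fin M, ‖phi B (m : ℕ) w‖ ^ 2 ≤ B / (2 * Real.pi) := by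
  have hs : 0 ≤ B * ‖w‖ ^ 2 / 2 := by positivity
  simp_rw [norm_phi_sq hB]
  rw [Fin.sum_univ_eq_sum_range (fun m => B / (2 * Real.pi) * ((B * ‖w‖ ^ 2 / 2) ^ m /
    m.factorial) * Real.exp (-(B * ‖w‖ ^ 2 / 2))), ← Finset.sum_mul, ← Finset.mul_sum, mul_assoc]
  refine mul_le_of_le_one_right (by positivity) ?_
  rw [Real.exp_neg, ← div_eq_mul_inv, div_le_one (Real.exp_pos _)]
  exact Real.sum_le_exp_of_nonneg hs M

theorem integral_norm_phi_sq {B : ℝ} (hB : 0 < B) (m : ℕ) : ∫ w, ‖phi B m w‖ ^ 2 = 1 := by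
  have h := Complex.integral_rpow_mul_exp_neg_mul_rpow (p := 2) (q := 2 * m) (b := B / 2)
    (by norm_num) (by have : (0 : ℝ) ≤ m := by positivity
                      linarith) (by positivity)
  have hG : ((2 * m + 2 : ℝ) / 2) = m + 1 := by ring
  rw [neg_div, hG, Real.Gamma_nat_eq_factorial] at h
  have heq : ∀ w : ℂ, ‖phi B m w‖ ^ 2 = B / (2 * Real.pi) * ((B / 2) ^ m / m.factorial) *
      (‖w‖ ^ (2 * m : ℝ) * Real.exp (-(B / 2) * ‖w‖ ^ (2 : ℝ))) := by
    intro w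
    rw [norm_phi_sq hB]
    have h1 : ‖w‖ ^ (2 * m : ℝ) = (‖w‖ ^ 2) ^ m := by
      rw [← pow_mul, ← Real.rpow_natCast]
      push_cast
      rfl
    rw [h1, Real.rpow_two, show B * ‖w‖ ^ 2 / 2 = B / 2 * ‖w‖ ^ 2 by ring, mul_pow, neg_mul]
    ring
  simp_rw [heq]
  rw [integral_const_mul, h, Real.rpow_neg (by positivity),
    show (m + 1 : ℝ) = ((m + 1 : ℕ) : ℝ) by push_cast; rfl, Real.rpow_natCast]
  have := Nat.factorial_ne_zero m
  have := Real.pi_pos.ne'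
  field_simp
  ring

theorem integral_exp_angle {k : ℂ} {n : ℤ} (hk : k = n) (hn : n ≠ 0) :
    ∫ θ in Set.Ioo (-Real.pi) Real.pi, Complex.exp (k * Complex.I * θ) = 0 := by
  have h0 : k * Complex.I ≠ 0 := by
    rw [hk]
    exact mul_ne_zero (by exact_mod_cast hn) Complex.I_ne_zero
  rw [← integral_Ioc_eq_integral_Ioo, ← intervalIntegral.integral_of_le (by linarith [Real.pi_pos]),
    integral_exp_mul_complex h0, div_eq_zero_iff]
  left
  rw [sub_eq_zero, Complex.exp_eq_exp_iff_exists_int]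
  refine ⟨n, ?_⟩
  rw [hk]
  push_cast
  ring

/-- Orthonormality of the orbitals; distinct angular momenta are orthogonal by integration over the
angle. -/
theorem integral_conj_phi_mul_phi {B : ℝ} (hB : 0 < B) (m m' : ℕ) :
    ∫ w, conj (phi B m w) * phi B m' w = if m = m' then 1 else 0 := by
  split_ifs with hm
  · subst hm
    rw [show (fun w => conj (phi B m w) * phi B m w) =
      fun w => ((‖phi B m w‖ ^ 2 : ℝ) : ℂ) by
        funext w
        rw [Complex.conj_mul']
        push_cast
        rfl, integral_complex_ofReal, integral_norm_phi_sq hB, Complex.ofReal_one]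
  · rw [← Complex.integral_comp_polarCoord_symm]
    have heq : ∀ p ∈ polarCoord.target, p.1 • (conj (phi B m (Complex.polarCoord.symm p)) *
        phi B m' (Complex.polarCoord.symm p)) =
        ((p.1 * phiRadial B m p.1 * phiRadial B m' p.1 : ℝ) : ℂ) *
          Complex.exp (((m : ℂ) - m') * Complex.I * p.2) := by
      intro p hp
      have hp1 : 0 < p.1 := hp.1
      have hp2 : p.2 ∈ Set.Ioc (-Real.pi) Real.pi := ⟨hp.2.1, hp.2.2.le⟩
      have harg : Complex.arg (Complex.polarCoord.symm p) = p.2 := by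
        rw [Complex.polarCoord_symm_apply, Complex.ofReal_cos, Complex.ofReal_sin]
        exact Complex.arg_mul_cos_add_sin_mul_I hp1 hp2
      rw [phi_eq, phi_eq, harg, Complex.norm_polarCoord_symm, abs_of_pos hp1, map_mul,
        Complex.conj_ofReal, ← Complex.exp_conj, Complex.real_smul]
      simp only [map_neg, map_mul, Complex.conj_I, Complex.conj_natCast, Complex.conj_ofReal]
      rw [show ((m : ℂ) - m') * Complex.I * p.2 =
        -(-Complex.I * m * p.2) + -(Complex.I * m' * p.2) by ring, Complex.exp_add]
      push_cast
      ring
    rw [setIntegral_congr_fun (by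
        exact measurableSet_Ioi.prod measurableSet_Ioo) heq]
    change ∫ p in Set.Ioi 0 ×ˢ Set.Ioo (-Real.pi) Real.pi, _ ∂(volume.prod volume) = _
    rw [setIntegral_prod_mul (fun r : ℝ => ((r * phiRadial B m r * phiRadial B m' r : ℝ) : ℂ))
      (fun θ : ℝ => Complex.exp (((m : ℂ) - m') * Complex.I * θ)),
      integral_exp_angle (n := (m : ℤ) - m') (by push_cast; rfl)
        (sub_ne_zero.2 (by exact_mod_cast hm)), mul_zero]

end Orbitals

/-! ### Products of axial wave functions, and densities -/

section SigmaPermutations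

variable {κ : Type*} [Fintype κ] [DecidableEq κ] {α : κ → Type*} [∀ m, Fintype (α m)]
  [∀ m, DecidableEq (α m)]

theorem sign_sigmaCongrRight (t : ∀ m, Equiv.Perm (α m)) :
    Equiv.Perm.sign (Equiv.Perm.sigmaCongrRight t) = ∏ m, Equiv.Perm.sign (t m) := by
  have h : (Equiv.Perm.sign.comp (Equiv.Perm.sigmaCongrRightHom α)) =
      (∏ m, Equiv.Perm.sign.comp (Pi.evalMonoidHom (fun m => Equiv.Perm (α m)) m) :
        (∀ m, Equiv.Perm (α m)) →* ℤˣ) := by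
    refine MonoidHom.pi_ext fun m x => ?_
    rw [MonoidHom.finsetProd_apply, Finset.prod_eq_single m]
    · simp only [MonoidHom.comp_apply, Pi.evalMonoidHom_apply, Pi.mulSingle_eq_same]
      symm
      refine Equiv.Perm.sign_bij (fun a _ => ⟨m, a⟩) ?_ ?_ ?_
      · intro a _ _
        simp [Equiv.Perm.sigmaCongrRightHom, Equiv.Perm.sigmaCongrRight]
      · intro a a' _ _ haa
        simpa using haa
      · rintro ⟨m', c⟩ hc
        by_cases hm : m' = m
        · subst hm
          refine ⟨c, fun hx => hc ?_, rfl⟩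
          simp [Equiv.Perm.sigmaCongrRightHom, Equiv.Perm.sigmaCongrRight, hx]
        · refine absurd ?_ hc
          simp [Equiv.Perm.sigmaCongrRightHom, Equiv.Perm.sigmaCongrRight,
            Pi.mulSingle_eq_of_ne hm]
    · intro m' _ hm
      simp [Pi.mulSingle_eq_of_ne hm]
    · simp
  have := DFunLike.congr_fun h t
  simpa [MonoidHom.finsetProd_apply, Equiv.Perm.sigmaCongrRightHom] using this

omit [Fintype κ] [DecidableEq κ] [∀ m, DecidableEq (α m)] in
theorem exists_eq_sigmaCongrRight (σ : Equiv.Perm (Σ m, α m)) (h : ∀ p, (σ p).1 = p.1) :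
    ∃ t : ∀ m, Equiv.Perm (α m), σ = Equiv.Perm.sigmaCongrRight t := by
  have hex : ∀ m (a : α m), ∃ a' : α m, σ ⟨m, a⟩ = ⟨m, a'⟩ := by
    intro m a
    have := h ⟨m, a⟩
    rcases hσ : σ ⟨m, a⟩ with ⟨m', a'⟩
    rw [hσ] at this
    dsimp only at this
    subst this
    exact ⟨a', rfl⟩
  choose f hf using hex
  have hinj : ∀ m, Function.Injective (f m) := by
    intro m a a' haa
    have : σ ⟨m, a⟩ = σ ⟨m, a'⟩ := by rw [hf, hf, haa]
    simpa using σ.injective this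
  refine ⟨fun m => Equiv.ofBijective (f m) (Finite.injective_iff_bijective.1 (hinj m)), ?_⟩
  ext1 ⟨m, a⟩
  rw [hf]
  rfl

end SigmaPermutations

section AxialProduct

variable {κ : Type*} [Fintype κ] {α : κ → Type*} [∀ m, Fintype (α m)]
  {ι : Type*} [Fintype ι] (e : (Σ m, α m) ≃ ι)

/-- The measurable equivalence that groups the axial coordinates by blocks. -/
def blockEquiv : (∀ m, α m → ℝ) ≃ᵐ (ι → ℝ) :=
  (MeasurableEquiv.piCurry (fun (m : κ) (_ : α m) => ℝ)).symm.trans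
    (MeasurableEquiv.piCongrLeft (fun _ => ℝ) e)

omit [Fintype κ] [∀ m, Fintype (α m)] [Fintype ι] in
theorem blockEquiv_apply (y : ∀ m, α m → ℝ) (q : Σ m, α m) : blockEquiv e y (e q) = y q.1 q.2 :=
  MeasurableEquiv.piCongrLeft_apply_apply (β := fun _ => ℝ) e _ q

omit [Fintype κ] [∀ m, Fintype (α m)] [Fintype ι] in
theorem blockEquiv_symm_apply (z : ι → ℝ) (m : κ) (a : α m) :
    (blockEquiv e).symm z m a = z (e ⟨m, a⟩) := by
  have := blockEquiv_apply e ((blockEquiv e).symm z) ⟨m, a⟩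
  rw [MeasurableEquiv.apply_symm_apply] at this
  exact this.symm

theorem measurePreserving_blockEquiv : MeasurePreserving (blockEquiv e) volume volume := by
  refine MeasurePreserving.trans (μb := volume) ⟨MeasurableEquiv.measurable _, ?_⟩
    (volume_measurePreserving_piCongrLeft (fun _ : ι => ℝ) e)
  symm
  refine Measure.pi_eq fun s hs => ?_
  rw [MeasurableEquiv.map_apply]
  have : (MeasurableEquiv.piCurry (fun (m : κ) (_ : α m) => ℝ)).symm ⁻¹' (Set.univ.pi s) =
      Set.univ.pi fun m => Set.univ.pi fun a => s ⟨m, a⟩ := by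
    ext y
    simp [MeasurableEquiv.coe_piCurry_symm, Sigma.uncurry, Set.mem_pi, Sigma.forall]
  rw [this, volume_pi_pi, Fintype.prod_sigma]
  exact Finset.prod_congr rfl fun m _ => volume_pi_pi _

/-- The product over the blocks `m` of wave functions `ψ m` of the axial coordinates of the
particles in block `m`. -/
def axialProduct (ψ : ∀ m, (α m → ℝ) → ℂ) (z : ι → ℝ) : ℂ :=
  ∏ m, ψ m fun a => z (e ⟨m, a⟩)

variable {ψ : ∀ m, (α m → ℝ) → ℂ}

omit [∀ m, Fintype (α m)] [Fintype ι] in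
theorem measurable_axialProduct (hψ : ∀ m, Measurable (ψ m)) :
    Measurable (axialProduct e ψ) :=
  Finset.measurable_prod _ fun m _ => (hψ m).comp (by fun_prop)

theorem integral_axialProduct (k : ∀ m, (α m → ℝ) → ℝ) :
    ∫ z, ‖axialProduct e ψ z‖ ^ 2 * ∏ m, k m (fun a => z (e ⟨m, a⟩)) =
      ∏ m, ∫ y, ‖ψ m y‖ ^ 2 * k m y := by
  rw [← integral_fintype_prod_volume_eq_prod (fun m (y : α m → ℝ) => ‖ψ m y‖ ^ 2 * k m y),
    ← (measurePreserving_blockEquiv e).symm.integral_comp'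
      (fun y : ∀ m, α m → ℝ => ∏ m, ‖ψ m (y m)‖ ^ 2 * k m (y m))]
  congr 1
  ext z
  rw [axialProduct, norm_prod, ← Finset.prod_pow, ← Finset.prod_mul_distrib]
  refine Finset.prod_congr rfl fun m _ => ?_
  have : (blockEquiv e).symm z m = fun a => z (e ⟨m, a⟩) :=
    funext fun a => blockEquiv_symm_apply e z m a
  rw [this]

theorem antisymm_axialProduct [DecidableEq κ] [∀ m, DecidableEq (α m)] [DecidableEq ι]
    (hanti : ∀ m, ∀ σ : Equiv.Perm (α m), ∀ᵐ y : α m → ℝ,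
      ψ m (fun a => y (σ a)) = ((Equiv.Perm.sign σ : ℤ) : ℂ) * ψ m y)
    (τ : Equiv.Perm ι) (hτ : ∀ p, (e.symm (τ p)).1 = (e.symm p).1) :
    ∀ᵐ z : ι → ℝ, axialProduct e ψ (fun i => z (τ i)) =
      ((Equiv.Perm.sign τ : ℤ) : ℂ) * axialProduct e ψ z := by
  set σ : Equiv.Perm (Σ m, α m) := e.symm.permCongr τ with hσ
  obtain ⟨t, ht⟩ := exists_eq_sigmaCongrRight σ fun p => by
    rw [hσ, Equiv.permCongr_apply, hτ, Equiv.symm_symm, Equiv.symm_apply_apply]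
  have hsign : Equiv.Perm.sign τ = ∏ m, Equiv.Perm.sign (t m) := by
    rw [← sign_sigmaCongrRight, ← ht, hσ, Equiv.Perm.sign_permCongr]
  have hτe : ∀ m (a : α m), τ (e ⟨m, a⟩) = e ⟨m, t m a⟩ := by
    intro m a
    have : σ ⟨m, a⟩ = ⟨m, t m a⟩ := by rw [ht]; rfl
    rw [← this, hσ, Equiv.permCongr_apply, Equiv.symm_symm, Equiv.apply_symm_apply]
  have hae : ∀ m, ∀ᵐ z : ι → ℝ, ψ m (fun a => z (e ⟨m, t m a⟩)) =
      ((Equiv.Perm.sign (t m) : ℤ) : ℂ) * ψ m (fun a => z (e ⟨m, a⟩)) := by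
    intro m
    have hq := (Measure.quasiMeasurePreserving_eval
      (fun m : κ => (volume : Measure (α m → ℝ))) m).comp
      (measurePreserving_blockEquiv e).symm.quasiMeasurePreserving
    filter_upwards [hq.ae (hanti m (t m))] with z hz
    simp only [Function.comp_apply, Function.eval] at hz
    have h1 : (blockEquiv e).symm z m = fun a => z (e ⟨m, a⟩) :=
      funext fun a => blockEquiv_symm_apply e z m a
    rwa [h1] at hz
  filter_upwards [ae_all_iff.2 hae] with z hz
  simp only [axialProduct, hτe, hz, hsign, Finset.prod_mul_distrib]
  push_cast
  rfl

/-- The expectation in `ψ m` of the product of `g` over the axial coordinates of those particles of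
block `m` that belong to `A`. -/
def innerWeight [DecidableEq ι] (ψ : ∀ m, (α m → ℝ) → ℂ) (g : ℝ → ℝ) (A : Finset ι) (m : κ) : ℝ :=
  ∫ y, ‖ψ m y‖ ^ 2 * ∏ a, if e ⟨m, a⟩ ∈ A then g (y a) else 1

variable [DecidableEq ι]

theorem axialWeight_axialProduct (g : ℝ → ℝ) (A : Finset ι) :
    axialWeight (axialProduct e ψ) g A = ∏ m, innerWeight e ψ g A m := by
  unfold innerWeight
  rw [← integral_axialProduct e (fun m y => ∏ a, if e ⟨m, a⟩ ∈ A then g (y a) else 1), axialWeight]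
  congr 1
  ext z
  congr 1
  rw [← Fintype.prod_sigma' (fun m a => if e ⟨m, a⟩ ∈ A then g (z (e ⟨m, a⟩)) else 1)]
  rw [Equiv.prod_comp e fun p => if p ∈ A then g (z p) else 1]
  simp [Finset.prod_ite_mem]

omit [Fintype κ] [Fintype ι] in
theorem innerWeight_congr (g : ℝ → ℝ) {A A' : Finset ι} {m : κ}
    (h : ∀ a, e ⟨m, a⟩ ∈ A ↔ e ⟨m, a⟩ ∈ A') : innerWeight e ψ g A m = innerWeight e ψ g A' m := by
  simp only [innerWeight, h]

omit [Fintype κ] [Fintype ι] in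
theorem innerWeight_of_disjoint (hnorm : ∀ m, ∫ y, ‖ψ m y‖ ^ 2 = 1) (g : ℝ → ℝ) {A : Finset ι}
    {m : κ} (h : ∀ p ∈ A, (e.symm p).1 ≠ m) : innerWeight e ψ g A m = 1 := by
  have : ∀ a, e ⟨m, a⟩ ∉ A := fun a ha => h _ ha (by simp)
  simp [innerWeight, this, hnorm]

/-- Particles in different blocks are independent in the axial state. -/
theorem axialWeight_pair [DecidableEq κ] (hnorm : ∀ m, ∫ y, ‖ψ m y‖ ^ 2 = 1) (g : ℝ → ℝ) {i j : ι}
    (hij : (e.symm i).1 ≠ (e.symm j).1) :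
    axialWeight (axialProduct e ψ) g {i, j} =
      axialWeight (axialProduct e ψ) g {i} * axialWeight (axialProduct e ψ) g {j} := by
  simp only [axialWeight_axialProduct]
  rw [← Finset.prod_mul_distrib]
  refine Finset.prod_congr rfl fun m _ => ?_
  by_cases hm : (e.symm j).1 = m
  · rw [innerWeight_of_disjoint e hnorm g (A := {i}) (m := m) (by simpa [← hm] using hij), one_mul]
    refine innerWeight_congr e g fun a => ?_
    have : e ⟨m, a⟩ ≠ i := by
      rintro rfl
      simp [← hm] at hij
    simp [this]
  · rw [innerWeight_of_disjoint e hnorm g (A := {j}) (m := m) (by simpa using hm), mul_one]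
    refine innerWeight_congr e g fun a => ?_
    have : e ⟨m, a⟩ ≠ j := by
      rintro rfl
      simp at hm
    simp [this]

theorem axialWeight_singleton [DecidableEq κ] (hnorm : ∀ m, ∫ y, ‖ψ m y‖ ^ 2 = 1) (g : ℝ → ℝ)
    (m : κ) (a : α m) :
    axialWeight (axialProduct e ψ) g {e ⟨m, a⟩} = ∫ y, ‖ψ m y‖ ^ 2 * g (y a) := by
  classical
  rw [axialWeight_axialProduct, Finset.prod_eq_single m]
  · simp [innerWeight]
  · intro m' _ hm
    exact innerWeight_of_disjoint e hnorm g (by simpa using hm.symm)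
  · simp

theorem isBlockState_axialProduct [DecidableEq κ] [∀ m, DecidableEq (α m)]
    (hψ : ∀ m, Measurable (ψ m)) (hnorm : ∀ m, ∫ y, ‖ψ m y‖ ^ 2 = 1)
    (hanti : ∀ m, ∀ σ : Equiv.Perm (α m), ∀ᵐ y : α m → ℝ,
      ψ m (fun a => y (σ a)) = ((Equiv.Perm.sign σ : ℤ) : ℂ) * ψ m y)
    {φ : κ → ℂ → ℂ} (hφ : ∀ m, Measurable (φ m))
    (horth : ∀ m m', ∫ w, conj (φ m w) * φ m' w = if m = m' then 1 else 0) :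
    IsBlockState (fun p => (e.symm p).1) φ (axialProduct e ψ) where
  measurable_orbital := hφ
  orthonormal := horth
  measurable_axial := measurable_axialProduct e hψ
  norm_axial := by
    have := integral_axialProduct e (ψ := ψ) fun _ _ => 1
    simpa [hnorm] using this
  antisymm := antisymm_axialProduct e hanti

end AxialProduct

section Density

/-- The defining property of the density: it computes the expectations of one-particle observables.
-/
theorem lintegral_density_mul {X : Type*} [MeasureSpace X] [SigmaFinite (volume : Measure X)]
    {N : ℕ} {ψ : (Fin N → X) → ℂ} (hψ : Measurable ψ) {f : X → ℝ≥0∞} (hf : Measurable f) :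
    ∫⁻ x, density ψ x * f x = ∑ i, ∫⁻ y : Fin N → X, ‖ψ y‖ₑ ^ 2 * f (y i) := by
  have hm : Measurable fun y : Fin N → X => ‖ψ y‖ₑ ^ 2 := by fun_prop
  have hconst : Measurable fun x : X => (fun _ : Fin N => x) := by fun_prop
  have hmarg : ∀ i : Fin N, Measurable fun x : X =>
      lmarginal (fun _ : Fin N => (volume : Measure X)) (Finset.univ.erase i)
        (fun y : Fin N → X => ‖ψ y‖ₑ ^ 2) (fun _ => x) := fun i =>
    (hm.lmarginal _).comp hconst
  simp only [density, Finset.sum_mul]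
  have hmul : ∀ i : Fin N, Measurable fun x : X =>
      lmarginal (fun _ : Fin N => (volume : Measure X)) (Finset.univ.erase i)
        (fun y : Fin N → X => ‖ψ y‖ₑ ^ 2) (fun _ => x) * f x := fun i => (hmarg i).mul hf
  rw [lintegral_finsetSum _ fun i _ => hmul i]
  refine Finset.sum_congr rfl fun i _ => ?_
  have hmf : Measurable fun y : Fin N → X => ‖ψ y‖ₑ ^ 2 * f (y i) := by fun_prop
  by_cases hX : Nonempty X
  · obtain ⟨x₀⟩ := hX
    rw [volume_pi, lintegral_eq_lmarginal_univ (fun _ => x₀),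
      lmarginal_erase _ hmf (Finset.mem_univ i)]
    refine lintegral_congr fun x => ?_
    have h1 : lmarginal (fun _ : Fin N => (volume : Measure X)) (Finset.univ.erase i)
        (fun y : Fin N → X => ‖ψ y‖ₑ ^ 2) (fun _ => x) =
        lmarginal (fun _ : Fin N => (volume : Measure X)) (Finset.univ.erase i)
        (fun y : Fin N → X => ‖ψ y‖ₑ ^ 2) (Function.update (fun _ => x₀) i x) := by
      refine lmarginal_congr _ _ fun j hj => ?_
      have : j = i := by simpa using hj
      rw [this, Function.update_self]
    rw [h1, lmarginal, lmarginal, ← lintegral_mul_const _ (by fun_prop)]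
    refine lintegral_congr fun y => ?_
    congr 2
    simp [Function.updateFinset]
  · have := not_nonempty_iff.1 hX
    have : IsEmpty (Fin N → X) := ⟨fun y => this.elim (y i)⟩
    rw [lintegral_of_isEmpty, lintegral_of_isEmpty]

end Density

/-! ### Gaussians and the Coulomb potential -/

section Inequalities

theorem ENNReal.two_mul_mul_le (a b : ℝ≥0∞) : 2 * (a * b) ≤ a ^ 2 + b ^ 2 := by
  rcases eq_or_ne a ⊤ with rfl | ha
  · simp
  rcases eq_or_ne b ⊤ with rfl | hb
  · simp
  lift a to NNReal using ha
  lift b to NNReal using hb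
  have := two_mul_le_add_sq a b
  rw [mul_assoc] at this
  exact_mod_cast this

theorem sq_lintegral_mul_le {X : Type*} [MeasurableSpace X] {μ : Measure X} {f g : X → ℝ≥0∞}
    (hf : AEMeasurable f μ) (hg : AEMeasurable g μ) :
    (∫⁻ x, f x * g x ∂μ) ^ 2 ≤ (∫⁻ x, f x ^ 2 ∂μ) * ∫⁻ x, g x ^ 2 ∂μ := by
  have h := ENNReal.lintegral_mul_le_Lp_mul_Lq μ Real.HolderConjugate.two_two hf hg
  simp only [Pi.mul_apply, ENNReal.rpow_two] at h
  calc _ ≤ ((∫⁻ x, f x ^ 2 ∂μ) ^ (1 / 2 : ℝ) * (∫⁻ x, g x ^ 2 ∂μ) ^ (1 / 2 : ℝ)) ^ 2 := by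
        gcongr
    _ = _ := by
        rw [mul_pow, ← ENNReal.rpow_natCast, ← ENNReal.rpow_natCast, ← ENNReal.rpow_mul,
          ← ENNReal.rpow_mul]
        norm_num

end Inequalities

section Gaussians

variable {V : Type*} [NormedAddCommGroup V]

/-- The Gaussian of width `1 / u` centred at `s`. The factor `2` is chosen so that integration of
`bump u s x * bump u s y` over `s` gives a multiple of `exp (-u ^ 2 * ‖x - y‖ ^ 2)`. -/
def bump (u : ℝ) (s x : V) : ℝ := Real.exp (-(2 * u ^ 2) * ‖x - s‖ ^ 2)

theorem bump_nonneg (u : ℝ) (s x : V) : 0 ≤ bump u s x := (Real.exp_pos _).le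

theorem bump_le_one (u : ℝ) (s x : V) : bump u s x ≤ 1 :=
  Real.exp_le_one_iff.2 (by nlinarith [mul_nonneg (sq_nonneg u) (sq_nonneg ‖x - s‖)])

@[fun_prop]
theorem Measurable.bump {X : Type*} [MeasurableSpace X] [MeasurableSpace V] [BorelSpace V]
    [SecondCountableTopology V] {u : X → ℝ} {s x : X → V} (hu : Measurable u) (hs : Measurable s)
    (hx : Measurable x) : Measurable fun t => bump (u t) (s t) (x t) := by
  unfold LandauBand.bump
  fun_prop

variable [InnerProductSpace ℝ V] [FiniteDimensional ℝ V] [MeasurableSpace V] [BorelSpace V]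

theorem lintegral_gaussian {a : ℝ} (ha : 0 < a) :
    ∫⁻ s : V, ENNReal.ofReal (Real.exp (-a * ‖s‖ ^ 2)) =
      ENNReal.ofReal ((Real.pi / a) ^ (Module.finrank ℝ V / 2 : ℝ)) := by
  have h := GaussianFourier.integral_rexp_neg_mul_sq_norm (V := V) ha
  have hpos : 0 < (Real.pi / a) ^ (Module.finrank ℝ V / 2 : ℝ) :=
    Real.rpow_pos_of_pos (div_pos Real.pi_pos ha) _
  have hint : Integrable fun s : V => Real.exp (-a * ‖s‖ ^ 2) := by
    by_contra hn
    rw [integral_undef hn] at h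
    exact hpos.ne h
  rw [← ofReal_integral_eq_lintegral_ofReal hint
    (Filter.Eventually.of_forall fun _ => (Real.exp_pos _).le), h]

theorem lintegral_bump {u : ℝ} (hu : 0 < u) (x : V) :
    ∫⁻ s : V, ENNReal.ofReal (bump u s x) =
      ENNReal.ofReal ((Real.pi / (2 * u ^ 2)) ^ (Module.finrank ℝ V / 2 : ℝ)) := by
  rw [← lintegral_gaussian (V := V) (a := 2 * u ^ 2) (by positivity)]
  exact lintegral_sub_left_eq_self
    (fun v : V => ENNReal.ofReal (Real.exp (-(2 * u ^ 2) * ‖v‖ ^ 2))) x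

theorem lintegral_bump' {u : ℝ} (hu : 0 < u) (s : V) :
    ∫⁻ x : V, ENNReal.ofReal (bump u s x) =
      ENNReal.ofReal ((Real.pi / (2 * u ^ 2)) ^ (Module.finrank ℝ V / 2 : ℝ)) := by
  rw [← lintegral_bump hu s]
  simp only [bump, norm_sub_rev]

/-- A Gaussian of the distance is a superposition of products of Gaussians. -/
theorem lintegral_bump_mul_bump {u : ℝ} (hu : 0 < u) (x y : V) :
    ∫⁻ s : V, ENNReal.ofReal (bump u s x) * ENNReal.ofReal (bump u s y) =
      ENNReal.ofReal ((Real.pi / (4 * u ^ 2)) ^ (Module.finrank ℝ V / 2 : ℝ)) *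
        ENNReal.ofReal (Real.exp (-u ^ 2 * ‖x - y‖ ^ 2)) := by
  rw [← lintegral_gaussian (V := V) (a := 4 * u ^ 2) (by positivity),
    ← lintegral_sub_left_eq_self
      (fun v : V => ENNReal.ofReal (Real.exp (-(4 * u ^ 2) * ‖v‖ ^ 2))) ((1 / 2 : ℝ) • (x + y)),
    ← lintegral_mul_const _ (by fun_prop)]
  refine lintegral_congr fun s => ?_
  rw [← ENNReal.ofReal_mul (bump_nonneg _ _ _), ← ENNReal.ofReal_mul (Real.exp_pos _).le,
    bump, bump, ← Real.exp_add, ← Real.exp_add]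
  congr 2
  have h := parallelogram_law_with_norm ℝ (x - s) (y - s)
  have h1 : (x - s) + (y - s) = (2 : ℝ) • ((1 / 2 : ℝ) • (x + y) - s) := by module
  have h2 : (x - s) - (y - s) = x - y := by abel
  rw [h1, h2, norm_smul, Real.norm_eq_abs, abs_two] at h
  linear_combination (-u ^ 2) * (-h)

end Gaussians

section Coulomb

/-- The Gaussian of width `1 / u` centred at `s` in three-dimensional space. -/
def spaceBump (u : ℝ) (s x : Space) : ℝ≥0∞ :=
  ENNReal.ofReal (bump u s.1 x.1 * bump u s.2 x.2)

@[fun_prop]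
theorem Measurable.spaceBump {X : Type*} [MeasurableSpace X] {u : X → ℝ} {s x : X → Space}
    (hu : Measurable u) (hs : Measurable s) (hx : Measurable x) :
    Measurable fun t => spaceBump (u t) (s t) (x t) := by
  unfold LandauBand.spaceBump
  fun_prop

theorem spaceBump_eq (u : ℝ) (s x : Space) :
    spaceBump u s x = ENNReal.ofReal (bump u s.1 x.1) * ENNReal.ofReal (bump u s.2 x.2) :=
  ENNReal.ofReal_mul (bump_nonneg _ _ _)

/-- The integral of the square of `spaceBump u s`. -/
def bumpNormSq (u : ℝ) : ℝ := Real.pi / (4 * u ^ 2) * (Real.sqrt Real.pi / (2 * u))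

/-- The weight of the Gaussians of width `1 / u` in the Coulomb potential: the weight of
`exp (-u ^ 2 * |x - y| ^ 2)` in `1 / |x - y|`, divided by the normalization `bumpNormSq u`. -/
def coulombWeight (u : ℝ) : ℝ := 2 / Real.sqrt Real.pi / bumpNormSq u

theorem bumpNormSq_pos {u : ℝ} (hu : 0 < u) : 0 < bumpNormSq u := by
  have := Real.pi_pos
  unfold bumpNormSq
  positivity

theorem coulombWeight_pos {u : ℝ} (hu : 0 < u) : 0 < coulombWeight u := by
  have := Real.pi_pos
  have := bumpNormSq_pos hu
  unfold coulombWeight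
  positivity

theorem gaussian_dim_one {c u : ℝ} (hc : 0 < c) (hu : 0 < u) :
    (Real.pi / (c * u ^ 2)) ^ (Module.finrank ℝ ℝ / 2 : ℝ) =
      Real.sqrt Real.pi / (Real.sqrt c * u) := by
  rw [Module.finrank_self, Nat.cast_one, ← Real.sqrt_eq_rpow, Real.sqrt_div Real.pi_pos.le,
    Real.sqrt_mul hc.le, Real.sqrt_sq hu.le]

theorem gaussian_dim_two {c u : ℝ} :
    (Real.pi / (c * u ^ 2)) ^ (Module.finrank ℝ ℂ / 2 : ℝ) = Real.pi / (c * u ^ 2) := by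
  rw [Complex.finrank_real_complex]
  norm_num

theorem lintegral_spaceBump_mul {u : ℝ} (hu : 0 < u) (x y : Space) :
    ∫⁻ s : Space, spaceBump u s x * spaceBump u s y = ENNReal.ofReal (bumpNormSq u) *
      ENNReal.ofReal (Real.exp (-(euclDist x y ^ 2) * u ^ 2)) := by
  have h : ∀ s : Space, spaceBump u s x * spaceBump u s y =
      (ENNReal.ofReal (bump u s.1 x.1) * ENNReal.ofReal (bump u s.1 y.1)) *
      (ENNReal.ofReal (bump u s.2 x.2) * ENNReal.ofReal (bump u s.2 y.2)) := by
    intro s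
    rw [spaceBump_eq, spaceBump_eq]
    ring
  have h4 : Real.sqrt 4 = 2 := by
    rw [show (4 : ℝ) = 2 ^ 2 by norm_num, Real.sqrt_sq (by norm_num)]
  simp_rw [h]
  rw [Measure.volume_eq_prod, lintegral_prod_mul
    (f := fun s : ℂ => ENNReal.ofReal (bump u s x.1) * ENNReal.ofReal (bump u s y.1))
    (g := fun s : ℝ => ENNReal.ofReal (bump u s x.2) * ENNReal.ofReal (bump u s y.2))
    (by fun_prop) (by fun_prop),
    lintegral_bump_mul_bump hu, lintegral_bump_mul_bump hu, gaussian_dim_one (by norm_num) hu,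
    gaussian_dim_two, h4, bumpNormSq, ENNReal.ofReal_mul (by positivity), euclDist,
    Real.sq_sqrt (by positivity), mul_mul_mul_comm, ← ENNReal.ofReal_mul (Real.exp_pos _).le,
    ← Real.exp_add, Real.norm_eq_abs, sq_abs]
  congr 3
  ring

theorem lintegral_spaceBump {u : ℝ} (hu : 0 < u) (x : Space) :
    ∫⁻ s : Space, spaceBump u s x =
      ENNReal.ofReal (Real.pi / (2 * u ^ 2) * (Real.sqrt Real.pi / (Real.sqrt 2 * u))) := by
  simp_rw [spaceBump_eq]
  rw [Measure.volume_eq_prod, lintegral_prod_mul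
    (f := fun s : ℂ => ENNReal.ofReal (bump u s x.1))
    (g := fun s : ℝ => ENNReal.ofReal (bump u s x.2))
    (by fun_prop) (by fun_prop),
    lintegral_bump hu, lintegral_bump hu, gaussian_dim_one (by norm_num) hu,
    gaussian_dim_two, ENNReal.ofReal_mul (by positivity)]

theorem coulomb_eq_lintegral_exp (x y : Space) :
    coulomb x y = ∫⁻ u in Set.Ioi (0 : ℝ), ENNReal.ofReal (2 / Real.sqrt Real.pi) *
      ENNReal.ofReal (Real.exp (-(euclDist x y ^ 2) * u ^ 2)) := by
  have hπ := Real.sqrt_pos.2 Real.pi_pos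
  rw [lintegral_const_mul _ (by fun_prop), coulomb]
  have h0 : 0 ≤ euclDist x y := Real.sqrt_nonneg _
  rcases h0.eq_or_lt with h | h
  · rw [← h]
    simp only [ne_eq, OfNat.ofNat_ne_zero, not_false_eq_true, zero_pow, neg_zero, zero_mul,
      Real.exp_zero, ENNReal.ofReal_one, ENNReal.ofReal_zero, ENNReal.inv_zero]
    rw [setLIntegral_one, Real.volume_Ioi, ENNReal.mul_top]
    exact (ENNReal.ofReal_pos.2 (by positivity)).ne'
  · have hg := integral_gaussian_Ioi (euclDist x y ^ 2)
    have hpos : 0 < Real.sqrt (Real.pi / euclDist x y ^ 2) / 2 := by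
      have := Real.pi_pos
      positivity
    have hint : Integrable (fun u : ℝ => Real.exp (-(euclDist x y ^ 2) * u ^ 2))
        (volume.restrict (Set.Ioi 0)) := by
      by_contra hn
      rw [integral_undef hn] at hg
      exact hpos.ne hg
    rw [← ofReal_integral_eq_lintegral_ofReal hint
      (Filter.Eventually.of_forall fun _ => (Real.exp_pos _).le), hg,
      ← ENNReal.ofReal_mul (by positivity), ← ENNReal.ofReal_inv_of_pos h,
      Real.sqrt_div Real.pi_pos.le, Real.sqrt_sq h.le]
    congr 1
    field_simp

/-- The Coulomb potential is a superposition of products of Gaussians. -/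
theorem coulomb_eq_lintegral (x y : Space) :
    coulomb x y = ∫⁻ u in Set.Ioi (0 : ℝ), ENNReal.ofReal (coulombWeight u) *
      ∫⁻ s : Space, spaceBump u s x * spaceBump u s y := by
  rw [coulomb_eq_lintegral_exp]
  refine setLIntegral_congr_fun measurableSet_Ioi fun u hu => ?_
  have hu' : 0 < u := hu
  have := bumpNormSq_pos hu'
  rw [lintegral_spaceBump_mul hu', ← mul_assoc,
    ← ENNReal.ofReal_mul (coulombWeight_pos hu').le, coulombWeight, div_mul_cancel₀ _ this.ne']

@[fun_prop]
theorem measurable_coulombWeight : Measurable coulombWeight := by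
  unfold coulombWeight bumpNormSq
  fun_prop

end Coulomb

/-! ### Energies as superpositions of Gaussian expectations -/

section Energies

theorem sum_offDiag_eq_two_mul {N : ℕ} (f : Fin N → Fin N → ℝ≥0∞) (hf : ∀ i j, f i j = f j i) :
    ∑ q ∈ (Finset.univ : Finset (Fin N)).offDiag, f q.1 q.2 =
      2 * ∑ i, ∑ j ∈ Finset.Ioi i, f i j := by
  have h1 : (∑ i, ∑ j ∈ Finset.Ioi i, f i j) = ∑ i, ∑ j, if i < j then f i j else 0 := by
    refine Finset.sum_congr rfl fun i _ => ?_
    rw [← Finset.sum_filter]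
    congr 1
    ext j
    simp
  have h2 : (∑ i, ∑ j, if i < j then f i j else 0) = ∑ i, ∑ j, if j < i then f i j else 0 := by
    rw [Finset.sum_comm]
    refine Finset.sum_congr rfl fun i _ => Finset.sum_congr rfl fun j _ => ?_
    rw [hf]
  rw [two_mul]
  nth_rewrite 2 [h1]
  rw [h2, h1, ← Finset.sum_add_distrib]
  simp_rw [← Finset.sum_add_distrib]
  rw [← Finset.sum_product', Finset.univ_product_univ, ← Finset.sum_subset
    (Finset.subset_univ (Finset.univ : Finset (Fin N)).offDiag)]
  · refine Finset.sum_congr rfl fun q hq => ?_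
    rcases lt_or_gt_of_ne (Finset.mem_offDiag.1 hq).2.2 with h | h
    · simp [h, h.not_gt]
    · simp [h, h.not_gt]
  · intro q _ hq
    have : q.1 = q.2 := by simpa using hq
    simp [this]

theorem euclDist_comm (x y : Space) : euclDist x y = euclDist y x := by
  unfold euclDist
  rw [norm_sub_rev]
  congr 2
  ring

theorem coulomb_comm (x y : Space) : coulomb x y = coulomb y x := by
  rw [coulomb, coulomb, euclDist_comm]

/-- The measure on the widths and centres of the Gaussians. -/
def bumpMeasure : Measure (ℝ × Space) :=
  (volume.restrict (Set.Ioi 0)).prod volume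

instance : SFinite bumpMeasure := by
  unfold bumpMeasure
  infer_instance

theorem lintegral_bumpMeasure {f : ℝ → Space → ℝ≥0∞} (hf : Measurable (Function.uncurry f)) :
    ∫⁻ p, ENNReal.ofReal (coulombWeight p.1) * f p.1 p.2 ∂bumpMeasure =
      ∫⁻ u in Set.Ioi 0, ENNReal.ofReal (coulombWeight u) * ∫⁻ s, f u s := by
  have hm : Measurable fun p : ℝ × Space => f p.1 p.2 := hf
  rw [bumpMeasure, lintegral_prod _ (by fun_prop)]
  refine lintegral_congr fun u => ?_
  exact lintegral_const_mul (ENNReal.ofReal (coulombWeight u)) (hf.of_uncurry_left (x := u))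

theorem coulomb_eq_lintegral_bumpMeasure (x y : Space) :
    coulomb x y = ∫⁻ p, ENNReal.ofReal (coulombWeight p.1) *
      (spaceBump p.1 p.2 x * spaceBump p.1 p.2 y) ∂bumpMeasure := by
  rw [coulomb_eq_lintegral, lintegral_bumpMeasure
    (f := fun u s => spaceBump u s x * spaceBump u s y)]
  unfold Function.uncurry
  fun_prop

variable {N : ℕ}

/-- `⟨Ψ | ∑_{i ≠ j} h(x_i) h(x_j) | Ψ⟩` for the Gaussian `h = spaceBump u s`. -/
def pairExpect (Ψ : (Fin N → Space) → ℂ) (u : ℝ) (s : Space) : ℝ≥0∞ :=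
  ∫⁻ x, ‖Ψ x‖ₑ ^ 2 * ∑ q ∈ (Finset.univ : Finset (Fin N)).offDiag,
    spaceBump u s (x q.1) * spaceBump u s (x q.2)

/-- `⟨Ψ | ∑_i h(x_i) | Ψ⟩` for the Gaussian `h = spaceBump u s`. -/
def oneExpect (Ψ : (Fin N → Space) → ℂ) (u : ℝ) (s : Space) : ℝ≥0∞ :=
  ∫⁻ x, ‖Ψ x‖ₑ ^ 2 * ∑ i, spaceBump u s (x i)

variable {Ψ : (Fin N → Space) → ℂ}

theorem measurable_pairExpect (hΨ : Measurable Ψ) :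
    Measurable (Function.uncurry (pairExpect Ψ)) := by
  unfold Function.uncurry pairExpect
  refine Measurable.lintegral_prod_right' (f := fun p : (ℝ × Space) × (Fin N → Space) =>
    ‖Ψ p.2‖ₑ ^ 2 * ∑ q ∈ (Finset.univ : Finset (Fin N)).offDiag,
      spaceBump p.1.1 p.1.2 (p.2 q.1) * spaceBump p.1.1 p.1.2 (p.2 q.2)) ?_
  fun_prop

theorem measurable_oneExpect (hΨ : Measurable Ψ) :
    Measurable (Function.uncurry (oneExpect Ψ)) := by
  unfold Function.uncurry oneExpect
  refine Measurable.lintegral_prod_right' (f := fun p : (ℝ × Space) × (Fin N → Space) =>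
    ‖Ψ p.2‖ₑ ^ 2 * ∑ i, spaceBump p.1.1 p.1.2 (p.2 i)) ?_
  fun_prop

theorem measurable_density {X : Type*} [MeasureSpace X] [SigmaFinite (volume : Measure X)]
    {ψ : (Fin N → X) → ℂ} (hψ : Measurable ψ) : Measurable (density ψ) := by
  have hm : Measurable fun y : Fin N → X => ‖ψ y‖ₑ ^ 2 := by fun_prop
  have hconst : Measurable fun x : X => (fun _ : Fin N => x) := by fun_prop
  exact Finset.measurable_fun_sum _ fun i _ => (hm.lmarginal _).comp hconst

theorem lintegral_density_mul_spaceBump (hΨ : Measurable Ψ) (u : ℝ) (s : Space) :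
    ∫⁻ x, density Ψ x * spaceBump u s x = oneExpect Ψ u s := by
  rw [lintegral_density_mul hΨ (by fun_prop), oneExpect, ← lintegral_finsetSum _ (by fun_prop)]
  simp_rw [Finset.mul_sum]

/-- The Coulomb energy as a superposition of Gaussian pair energies. -/
theorem two_mul_coulombEnergy (hΨ : Measurable Ψ) :
    2 * coulombEnergy Ψ = ∫⁻ u in Set.Ioi 0, ENNReal.ofReal (coulombWeight u) *
      ∫⁻ s, pairExpect Ψ u s := by
  rw [← lintegral_bumpMeasure (measurable_pairExpect hΨ), coulombEnergy,
    ← lintegral_const_mul' _ _ (by norm_num)]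
  have h : ∀ x : Fin N → Space,
      2 * ((∑ i : Fin N, ∑ j ∈ Finset.Ioi i, coulomb (x i) (x j)) * ‖Ψ x‖ₑ ^ 2) =
      ∫⁻ p, ENNReal.ofReal (coulombWeight p.1) * (‖Ψ x‖ₑ ^ 2 *
        ∑ q ∈ (Finset.univ : Finset (Fin N)).offDiag,
          spaceBump p.1 p.2 (x q.1) * spaceBump p.1 p.2 (x q.2)) ∂bumpMeasure := by
    intro x
    rw [← mul_assoc, ← sum_offDiag_eq_two_mul (fun i j => coulomb (x i) (x j))
      (fun i j => coulomb_comm _ _)]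
    simp_rw [coulomb_eq_lintegral_bumpMeasure]
    rw [← lintegral_finsetSum _ (by fun_prop), ← lintegral_mul_const _ (by fun_prop)]
    refine lintegral_congr fun p => ?_
    rw [← Finset.mul_sum]
    ring
  simp_rw [h]
  rw [lintegral_lintegral_swap (by unfold Function.uncurry; fun_prop)]
  refine lintegral_congr fun p => ?_
  rw [lintegral_const_mul _ (by fun_prop), pairExpect]

/-- The direct energy as a superposition of squares of Gaussian means. -/
theorem two_mul_directEnergy (hΨ : Measurable Ψ) :
    2 * directEnergy (density Ψ) = ∫⁻ u in Set.Ioi 0, ENNReal.ofReal (coulombWeight u) *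
      ∫⁻ s, oneExpect Ψ u s ^ 2 := by
  have hone : Measurable fun p : ℝ × Space => oneExpect Ψ p.1 p.2 := measurable_oneExpect hΨ
  have hρ := measurable_density hΨ
  rw [← lintegral_bumpMeasure (f := fun u s => oneExpect Ψ u s ^ 2)
    (by unfold Function.uncurry; fun_prop), directEnergy, ← mul_assoc,
    ENNReal.mul_inv_cancel (by norm_num) (by norm_num), one_mul]
  have h1 : ∀ x, ∫⁻ y : Space, density Ψ x * density Ψ y * coulomb x y =
      ∫⁻ p, ENNReal.ofReal (coulombWeight p.1) * (density Ψ x * spaceBump p.1 p.2 x) *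
        oneExpect Ψ p.1 p.2 ∂bumpMeasure := by
    intro x
    simp_rw [coulomb_eq_lintegral_bumpMeasure]
    calc _ = ∫⁻ y : Space, ∫⁻ p, density Ψ x * density Ψ y *
          (ENNReal.ofReal (coulombWeight p.1) *
            (spaceBump p.1 p.2 x * spaceBump p.1 p.2 y)) ∂bumpMeasure := by
          refine lintegral_congr fun y => ?_
          rw [lintegral_const_mul _ (by fun_prop)]
      _ = _ := by
          rw [lintegral_lintegral_swap (by unfold Function.uncurry; fun_prop)]
          refine lintegral_congr fun p => ?_
          rw [← lintegral_density_mul_spaceBump hΨ, ← lintegral_const_mul _ (by fun_prop)]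
          refine lintegral_congr fun y => ?_
          ring
  simp_rw [h1]
  rw [lintegral_lintegral_swap (by unfold Function.uncurry; fun_prop)]
  refine lintegral_congr fun p => ?_
  rw [lintegral_mul_const _ (by fun_prop), lintegral_const_mul _ (by fun_prop),
    lintegral_density_mul_spaceBump hΨ]
  ring

theorem lintegral_oneExpect (hΨ : Measurable Ψ) (hnorm : ∫⁻ x, ‖Ψ x‖ₑ ^ 2 = 1) {u : ℝ}
    (hu : 0 < u) : ∫⁻ s, oneExpect Ψ u s = N *
      ENNReal.ofReal (Real.pi / (2 * u ^ 2) * (Real.sqrt Real.pi / (Real.sqrt 2 * u))) := by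
  unfold oneExpect
  rw [lintegral_lintegral_swap (by unfold Function.uncurry; fun_prop)]
  have : ∀ x : Fin N → Space, ∫⁻ s, ‖Ψ x‖ₑ ^ 2 * ∑ i, spaceBump u s (x i) = ‖Ψ x‖ₑ ^ 2 * (N *
      ENNReal.ofReal (Real.pi / (2 * u ^ 2) * (Real.sqrt Real.pi / (Real.sqrt 2 * u)))) := by
    intro x
    rw [lintegral_const_mul _ (by fun_prop), lintegral_finsetSum _ (by fun_prop)]
    simp [lintegral_spaceBump hu]
  simp_rw [this]
  rw [lintegral_mul_const _ (by fun_prop), hnorm, one_mul]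

/-- The Onsager-type bound: by the Cauchy-Schwarz inequality, the direct energy of the Gaussians of
a given width exceeds the pair energy by at most the self-energy of the particles. -/
theorem lintegral_oneExpect_sq_le (hΨ : Measurable Ψ) (hnorm : ∫⁻ x, ‖Ψ x‖ₑ ^ 2 = 1) {u : ℝ}
    (hu : 0 < u) : ENNReal.ofReal (coulombWeight u) * ∫⁻ s, oneExpect Ψ u s ^ 2 ≤
      ENNReal.ofReal (coulombWeight u) * (∫⁻ s, pairExpect Ψ u s) +
        N * ENNReal.ofReal (2 / Real.sqrt Real.pi) := by
  have hpair : Measurable fun s => pairExpect Ψ u s :=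
    (measurable_pairExpect hΨ).of_uncurry_left
  have hs : ∀ s, oneExpect Ψ u s ^ 2 ≤ pairExpect Ψ u s +
      ∫⁻ x, ‖Ψ x‖ₑ ^ 2 * ∑ i, spaceBump u s (x i) * spaceBump u s (x i) := by
    intro s
    have hcs := sq_lintegral_mul_le (μ := (volume : Measure (Fin N → Space)))
      (f := fun x => ‖Ψ x‖ₑ) (g := fun x => ‖Ψ x‖ₑ * ∑ i, spaceBump u s (x i))
      (by fun_prop) (by fun_prop)
    rw [hnorm, one_mul] at hcs
    rw [pairExpect, ← lintegral_add_left (by fun_prop), oneExpect]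
    calc _ = (∫⁻ x, ‖Ψ x‖ₑ * (‖Ψ x‖ₑ * ∑ i, spaceBump u s (x i))) ^ 2 := by
          simp_rw [sq ‖Ψ _‖ₑ, mul_assoc]
      _ ≤ _ := hcs
      _ = _ := by
          refine lintegral_congr fun x => ?_
          rw [mul_pow, ← mul_add, sq (Finset.sum _ _), Finset.sum_mul_sum, ← Finset.sum_product',
            ← Finset.diag_union_offDiag, Finset.sum_union (Finset.disjoint_diag_offDiag _),
            Finset.sum_diag, add_comm]
  have hself : ∫⁻ s, ∫⁻ x, ‖Ψ x‖ₑ ^ 2 * ∑ i, spaceBump u s (x i) * spaceBump u s (x i) =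
      N * ENNReal.ofReal (bumpNormSq u) := by
    rw [lintegral_lintegral_swap (by unfold Function.uncurry; fun_prop)]
    have : ∀ x : Fin N → Space, ∫⁻ s, ‖Ψ x‖ₑ ^ 2 * ∑ i, spaceBump u s (x i) * spaceBump u s (x i) =
        ‖Ψ x‖ₑ ^ 2 * (N * ENNReal.ofReal (bumpNormSq u)) := by
      intro x
      rw [lintegral_const_mul _ (by fun_prop), lintegral_finsetSum _ (by fun_prop)]
      simp [lintegral_spaceBump_mul hu, euclDist]
    simp_rw [this]
    rw [lintegral_mul_const _ (by fun_prop), hnorm, one_mul]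
  have hc : ENNReal.ofReal (coulombWeight u) * ENNReal.ofReal (bumpNormSq u) =
      ENNReal.ofReal (2 / Real.sqrt Real.pi) := by
    rw [← ENNReal.ofReal_mul (coulombWeight_pos hu).le, coulombWeight,
      div_mul_cancel₀ _ (bumpNormSq_pos hu).ne']
  calc _ ≤ ENNReal.ofReal (coulombWeight u) * ∫⁻ s, (pairExpect Ψ u s +
      ∫⁻ x, ‖Ψ x‖ₑ ^ 2 * ∑ i, spaceBump u s (x i) * spaceBump u s (x i)) := by
        gcongr with s
        exact hs s
    _ = _ := by
        rw [lintegral_add_left hpair, hself, mul_add, mul_left_comm, hc]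

end Energies

/-! ### Gaussian matrix elements of orthonormal orbitals -/

section OverlapBounds

theorem enorm_sq_eq_ofReal (a : ℂ) : ‖a‖ₑ ^ 2 = ENNReal.ofReal (‖a‖ ^ 2) := by
  rw [ENNReal.ofReal_pow (norm_nonneg _), ofReal_norm]

theorem ofReal_sqrt_sq {a : ℝ} (ha : 0 ≤ a) :
    ENNReal.ofReal (Real.sqrt a) ^ 2 = ENNReal.ofReal a := by
  rw [← ENNReal.ofReal_pow (Real.sqrt_nonneg _), Real.sq_sqrt ha]

/-- The passage between the Bochner and the Lebesgue integral in expectations of bounded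
nonnegative observables. -/
theorem lintegral_normSq_mul {X : Type*} [MeasurableSpace X] {μ : Measure X} {f : X → ℂ}
    (hf : Integrable (fun x => ‖f x‖ ^ 2) μ) {K : X → ℝ} (hK : Measurable K) (hK0 : ∀ x, 0 ≤ K x)
    {C : ℝ} (hKC : ∀ x, K x ≤ C) :
    ∫⁻ x, ‖f x‖ₑ ^ 2 * ENNReal.ofReal (K x) ∂μ = ENNReal.ofReal (∫ x, ‖f x‖ ^ 2 * K x ∂μ) := by
  rw [ofReal_integral_eq_lintegral_ofReal]
  · simp_rw [enorm_sq_eq_ofReal, ENNReal.ofReal_mul (sq_nonneg _)]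
  · exact hf.mul_bdd (c := C) hK.aestronglyMeasurable (Filter.Eventually.of_forall fun x => by
      rw [Real.norm_eq_abs, abs_of_nonneg (hK0 x)]; exact hKC x)
  · exact Filter.Eventually.of_forall fun x => mul_nonneg (sq_nonneg _) (hK0 x)

theorem lintegral_normSq {X : Type*} [MeasurableSpace X] {μ : Measure X} {f : X → ℂ}
    (hf : ∫ x, ‖f x‖ ^ 2 ∂μ = 1) : ∫⁻ x, ‖f x‖ₑ ^ 2 ∂μ = 1 := by
  have hint : Integrable (fun x => ‖f x‖ ^ 2) μ := by
    by_contra hn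
    rw [integral_undef hn] at hf
    exact zero_ne_one hf
  have := lintegral_normSq_mul hint (K := fun _ => 1) measurable_const (by simp) (C := 1) (by simp)
  simpa [hf] using this

variable {κ : Type*} {φ : κ → ℂ → ℂ}
  (hφm : ∀ m, Measurable (φ m))

include hφm

theorem measurable_overlap_bump (u : ℝ) (m m' : κ) :
    Measurable fun s : ℂ => overlap φ (bump u s) m m' := by
  unfold overlap
  refine StronglyMeasurable.measurable ?_
  refine StronglyMeasurable.integral_prod_right' (f := fun p : ℂ × ℂ =>
    conj (φ m p.2) * φ m' p.2 * (bump u p.1 p.2 : ℂ)) ?_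
  refine Measurable.stronglyMeasurable ?_
  have h1 : Measurable fun p : ℂ × ℂ => conj (φ m p.2) :=
    Complex.continuous_conj.measurable.comp ((hφm m).comp measurable_snd)
  have h2 : Measurable fun p : ℂ × ℂ => φ m' p.2 := (hφm m').comp measurable_snd
  exact (h1.mul h2).mul (Complex.measurable_ofReal.comp (by fun_prop))

theorem enorm_overlap_sq_le {g : ℂ → ℝ} (hg : Measurable g) (hg0 : ∀ w, 0 ≤ g w) (m m' : κ) :
    ‖overlap φ g m m'‖ₑ ^ 2 ≤ (∫⁻ w, ‖φ m w‖ₑ ^ 2 * ENNReal.ofReal (g w)) *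
      ∫⁻ w, ‖φ m' w‖ₑ ^ 2 * ENNReal.ofReal (g w) := by
  have h := sq_lintegral_mul_le (μ := (volume : Measure ℂ))
    (f := fun w => ‖φ m w‖ₑ * ENNReal.ofReal (Real.sqrt (g w)))
    (g := fun w => ‖φ m' w‖ₑ * ENNReal.ofReal (Real.sqrt (g w))) (by fun_prop) (by fun_prop)
  simp_rw [mul_pow, ofReal_sqrt_sq (hg0 _)] at h
  refine le_trans ?_ h
  gcongr
  refine (enorm_integral_le_lintegral_enorm _).trans (le_of_eq (lintegral_congr fun w => ?_))
  rw [enorm_mul, enorm_mul, mul_mul_mul_comm, ← sq, ofReal_sqrt_sq (hg0 w)]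
  congr 2
  · rw [← ofReal_norm, RCLike.norm_conj, ofReal_norm]
  · rw [← ofReal_norm, Complex.norm_real, Real.norm_eq_abs, abs_of_nonneg (hg0 w)]

omit hφm in
theorem integral_normSq_orbital [DecidableEq κ]
    (horth : ∀ m m', ∫ w, conj (φ m w) * φ m' w = if m = m' then 1 else 0) (m : κ) :
    ∫ w, ‖φ m w‖ ^ 2 = 1 := by
  have h := horth m m
  rw [if_pos rfl, show (fun w => conj (φ m w) * φ m w) = fun w => ((‖φ m w‖ ^ 2 : ℝ) : ℂ) by
    funext w
    rw [Complex.conj_mul']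
    push_cast
    rfl, integral_complex_ofReal] at h
  exact_mod_cast h

omit hφm in
theorem inner_toLp {f g : ℂ → ℂ} (hf : MemLp f 2) (hg : MemLp g 2) :
    inner ℂ (hf.toLp f) (hg.toLp g) = ∫ w, conj (f w) * g w := by
  rw [L2.inner_def]
  refine integral_congr_ae ?_
  filter_upwards [hf.coeFn_toLp, hg.coeFn_toLp] with w h1 h2
  rw [h1, h2, RCLike.inner_apply, mul_comm]

variable [Fintype κ] [DecidableEq κ]
  (horth : ∀ m m', ∫ w, conj (φ m w) * φ m' w = if m = m' then 1 else 0)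

include horth

/-- Bessel's inequality for the matrix elements of a one-particle observable. -/
theorem sum_enorm_overlap_sq_le {g : ℂ → ℝ} (hg : Measurable g) (hg0 : ∀ w, 0 ≤ g w)
    (hg1 : ∀ w, g w ≤ 1) (m : κ) :
    ∑ m', ‖overlap φ g m m'‖ₑ ^ 2 ≤
      ∫⁻ w, ‖φ m w‖ₑ ^ 2 * (ENNReal.ofReal (g w) * ENNReal.ofReal (g w)) := by
  have hint : ∀ m, Integrable fun w => ‖φ m w‖ ^ 2 := by
    intro m
    by_contra hn
    have := integral_normSq_orbital horth m
    rw [integral_undef hn] at this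
    exact zero_ne_one this
  have hLp : ∀ m, MemLp (φ m) 2 := fun m =>
    (memLp_two_iff_integrable_sq_norm (hφm m).aestronglyMeasurable).2 (hint m)
  have hgφm : Measurable fun w => (g w : ℂ) * φ m w :=
    (Complex.measurable_ofReal.comp hg).mul (hφm m)
  have hgφ : MemLp (fun w => (g w : ℂ) * φ m w) 2 := by
    refine (hLp m).of_le hgφm.aestronglyMeasurable (Filter.Eventually.of_forall fun w => ?_)
    rw [norm_mul, Complex.norm_real, Real.norm_eq_abs, abs_of_nonneg (hg0 w)]
    exact mul_le_of_le_one_left (norm_nonneg _) (hg1 w)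
  have hON : Orthonormal ℂ fun m' => (hLp m').toLp (φ m') := by
    rw [orthonormal_iff_ite]
    intro m₁ m₂
    rw [inner_toLp, horth]
  have hbessel := hON.sum_inner_products_le (s := Finset.univ) (hgφ.toLp _)
  have hov : ∀ m', ‖inner ℂ ((hLp m').toLp (φ m')) (hgφ.toLp _)‖ = ‖overlap φ g m m'‖ := by
    intro m'
    rw [inner_toLp, ← RCLike.norm_conj (overlap φ g m m'), ← overlap_conj, overlap]
    congr 2
    ext w
    ring
  have hnorm : ‖hgφ.toLp _‖ ^ 2 = ∫ w, ‖φ m w‖ ^ 2 * (g w * g w) := by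
    have h1 : inner ℂ (hgφ.toLp _) (hgφ.toLp _) =
        ((∫ w, ‖φ m w‖ ^ 2 * (g w * g w) : ℝ) : ℂ) := by
      rw [inner_toLp, ← integral_complex_ofReal]
      congr 1
      ext w
      rw [map_mul, Complex.conj_ofReal, Complex.ofReal_mul, Complex.ofReal_pow,
        ← Complex.conj_mul']
      push_cast
      ring
    rw [← inner_self_eq_norm_sq (𝕜 := ℂ), h1]
    exact Complex.ofReal_re _
  simp_rw [hov, hnorm] at hbessel
  simp_rw [← ENNReal.ofReal_mul (hg0 _)]
  rw [lintegral_normSq_mul (hint m) (K := fun w => g w * g w) (hg.mul hg)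
    (fun w => mul_nonneg (hg0 w) (hg0 w)) (C := 1) (fun w => mul_le_one₀ (hg1 w) (hg0 w) (hg1 w))]
  simp_rw [enorm_sq_eq_ofReal]
  rw [← ENNReal.ofReal_sum_of_nonneg fun _ _ => sq_nonneg _]
  exact ENNReal.ofReal_le_ofReal hbessel

/-- The bound that is used when the Gaussians are wide compared with `1 / √B`. -/
theorem sum_lintegral_overlap_le_of_bessel {u : ℝ} (hu : 0 < u) (m : κ) :
    ∑ m', ∫⁻ s, ‖overlap φ (bump u s) m m'‖ₑ ^ 2 ≤ ENNReal.ofReal (Real.pi / (4 * u ^ 2)) := by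
  have hm := hφm m
  rw [← lintegral_finsetSum _ fun m' _ => ((measurable_overlap_bump hφm u m m').enorm.pow_const 2)]
  calc _ ≤ ∫⁻ s, ∫⁻ w, ‖φ m w‖ₑ ^ 2 *
        (ENNReal.ofReal (bump u s w) * ENNReal.ofReal (bump u s w)) :=
        lintegral_mono fun s => sum_enorm_overlap_sq_le hφm horth (by fun_prop)
          (bump_nonneg u s) (bump_le_one u s) m
    _ = ∫⁻ w, ‖φ m w‖ₑ ^ 2 * ENNReal.ofReal (Real.pi / (4 * u ^ 2)) := by
        rw [lintegral_lintegral_swap (by unfold Function.uncurry; fun_prop)]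
        refine lintegral_congr fun w => ?_
        rw [lintegral_const_mul _ (by fun_prop), lintegral_bump_mul_bump hu, gaussian_dim_two]
        simp
    _ = _ := by
        rw [lintegral_mul_const _ (by fun_prop),
          lintegral_normSq (integral_normSq_orbital horth m), one_mul]

/-- The bound that is used when the Gaussians are narrow compared with `1 / √B`: each overlap is
bounded by the Cauchy-Schwarz inequality, and the sum of the densities of the orbitals by `B / 2π`.
-/
theorem sum_lintegral_overlap_le_of_density {B : ℝ}
    (hdens : ∀ w, ∑ m, ‖φ m w‖ ^ 2 ≤ B / (2 * Real.pi)) {u : ℝ} (hu : 0 < u) (m : κ) :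
    ∑ m', ∫⁻ s, ‖overlap φ (bump u s) m m'‖ₑ ^ 2 ≤
      ENNReal.ofReal (B / (2 * Real.pi) * (Real.pi / (2 * u ^ 2)) ^ 2) := by
  have hB : 0 ≤ B / (2 * Real.pi) :=
    (Finset.sum_nonneg fun _ _ => sq_nonneg _).trans (hdens 0)
  have hG : 0 ≤ Real.pi / (2 * u ^ 2) := by
    have := Real.pi_pos
    positivity
  rw [← lintegral_finsetSum _ fun m' _ => ((measurable_overlap_bump hφm u m m').enorm.pow_const 2)]
  calc _ ≤ ∫⁻ s, (∫⁻ w, ‖φ m w‖ₑ ^ 2 * ENNReal.ofReal (bump u s w)) *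
        ENNReal.ofReal (B / (2 * Real.pi) * (Real.pi / (2 * u ^ 2))) := by
        refine lintegral_mono fun s => ?_
        refine (Finset.sum_le_sum fun m' _ => enorm_overlap_sq_le hφm
          (g := bump u s) (by fun_prop) (bump_nonneg u s) m m').trans ?_
        rw [← Finset.mul_sum, ← lintegral_finsetSum _ fun m' _ => by have := hφm m'; fun_prop]
        gcongr
        calc _ ≤ ∫⁻ w, ENNReal.ofReal (B / (2 * Real.pi)) * ENNReal.ofReal (bump u s w) := by
              refine lintegral_mono fun w => ?_
              rw [← Finset.sum_mul]
              gcongr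
              simp_rw [enorm_sq_eq_ofReal]
              rw [← ENNReal.ofReal_sum_of_nonneg fun _ _ => sq_nonneg _]
              exact ENNReal.ofReal_le_ofReal (hdens w)
          _ = _ := by
              rw [lintegral_const_mul _ (by fun_prop), lintegral_bump' hu, gaussian_dim_two,
                ENNReal.ofReal_mul hB]
    _ = _ := by
        have hm := hφm m
        rw [lintegral_mul_const _ (by
            refine Measurable.lintegral_prod_right' (f := fun p : ℂ × ℂ =>
              ‖φ m p.2‖ₑ ^ 2 * ENNReal.ofReal (bump u p.1 p.2)) ?_
            fun_prop), lintegral_lintegral_swap (by unfold Function.uncurry; fun_prop)]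
        have : ∀ w, ∫⁻ s, ‖φ m w‖ₑ ^ 2 * ENNReal.ofReal (bump u s w) =
            ‖φ m w‖ₑ ^ 2 * ENNReal.ofReal (Real.pi / (2 * u ^ 2)) := by
          intro w
          rw [lintegral_const_mul _ (by fun_prop), lintegral_bump hu, gaussian_dim_two]
        simp_rw [this]
        rw [lintegral_mul_const _ (by fun_prop),
          lintegral_normSq (integral_normSq_orbital horth m), one_mul, ← ENNReal.ofReal_mul hG]
        congr 1
        ring

end OverlapBounds

section Convolution

/-- Young's inequality for the convolution of a density with a Gaussian. -/
theorem lintegral_sq_lintegral_mul_bump_le {ρ : ℝ → ℝ≥0∞} (hρ : Measurable ρ) {u : ℝ}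
    (hu : 0 < u) :
    ∫⁻ s, (∫⁻ z, ρ z * ENNReal.ofReal (bump u s z)) ^ 2 ≤
      ENNReal.ofReal (Real.pi / (2 * u ^ 2)) * ∫⁻ z, ρ z ^ 2 := by
  set G := ENNReal.ofReal (Real.sqrt Real.pi / (Real.sqrt 2 * u)) with hGdef
  have hGG : G * G = ENNReal.ofReal (Real.pi / (2 * u ^ 2)) := by
    rw [hGdef, ← ENNReal.ofReal_mul (by positivity)]
    congr 1
    rw [div_mul_div_comm, Real.mul_self_sqrt Real.pi_pos.le, mul_mul_mul_comm,
      Real.mul_self_sqrt (by norm_num), sq]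
  have hs : ∀ s, (∫⁻ z, ρ z * ENNReal.ofReal (bump u s z)) ^ 2 ≤
      G * ∫⁻ z, ρ z ^ 2 * ENNReal.ofReal (bump u s z) := by
    intro s
    have h := sq_lintegral_mul_le (μ := (volume : Measure ℝ))
      (f := fun z => ENNReal.ofReal (Real.sqrt (bump u s z)))
      (g := fun z => ρ z * ENNReal.ofReal (Real.sqrt (bump u s z))) (by fun_prop) (by fun_prop)
    simp_rw [mul_pow, ofReal_sqrt_sq (bump_nonneg u s _)] at h
    rw [lintegral_bump' hu, gaussian_dim_one (by norm_num) hu] at h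
    refine le_trans (le_of_eq ?_) h
    congr 1
    refine lintegral_congr fun z => ?_
    rw [mul_left_comm, ← sq, ofReal_sqrt_sq (bump_nonneg u s _)]
  calc _ ≤ ∫⁻ s, G * ∫⁻ z, ρ z ^ 2 * ENNReal.ofReal (bump u s z) := lintegral_mono hs
    _ = G * ∫⁻ z, ρ z ^ 2 * G := by
        rw [lintegral_const_mul' _ _ ENNReal.ofReal_ne_top,
          lintegral_lintegral_swap (by unfold Function.uncurry; fun_prop)]
        congr 1
        refine lintegral_congr fun z => ?_
        rw [lintegral_const_mul _ (by fun_prop), lintegral_bump hu,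
          gaussian_dim_one (by norm_num) hu]
    _ = _ := by
        rw [lintegral_mul_const _ (by fun_prop), ← hGG]
        ring

end Convolution

/-! ### Block states tested with Gaussians -/

section BlockBounds

variable {N : ℕ} {κ : Type*} [Fintype κ] [DecidableEq κ] {b : Fin N → κ} {φ : κ → ℂ → ℂ}
  {F : (Fin N → ℝ) → ℂ}

namespace IsBlockState

variable (h : IsBlockState b φ F) {c : ℝ}

include h

omit [Fintype κ] in
theorem measurable_antisymmetrize : Measurable (antisymmetrize c (blockProduct b φ F)) := by
  have hm : Measurable (blockProduct b φ F) := by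
    refine (h.measurable_axial.comp (by fun_prop)).mul ?_
    exact Finset.measurable_fun_prod _ fun p _ => (h.measurable_orbital _).comp (by fun_prop)
  unfold antisymmetrize
  refine measurable_const.mul (Finset.measurable_fun_sum _ fun σ _ => ?_)
  exact measurable_const.mul (hm.comp (by fun_prop))

variable (hc : c ^ 2 * (Fintype.card (Fin N)).factorial * (blockPerms b).card = 1)

include hc

omit [Fintype κ] in
theorem integrable_normSq_antisymmetrize :
    Integrable fun x => ‖antisymmetrize c (blockProduct b φ F) x‖ ^ 2 := by
  by_contra hn
  have := h.norm_antisymmetrize hc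
  rw [integral_undef hn] at this
  exact zero_ne_one this

omit [Fintype κ] in
theorem oneExpect_eq (u : ℝ) (s : Space) :
    oneExpect (antisymmetrize c (blockProduct b φ F)) u s = ENNReal.ofReal
      (∑ i, orbitalWeight φ (bump u s.1) (b i) * axialWeight F (bump u s.2) {i}) := by
  rw [← h.integral_one_body hc (by fun_prop) (bump_nonneg _ _) (bump_le_one _ _) (by fun_prop)
    (bump_nonneg _ _) (bump_le_one _ _), ← lintegral_normSq_mul
    (h.integrable_normSq_antisymmetrize hc) (by fun_prop) ?_ (C := N), oneExpect]
  · refine lintegral_congr fun x => ?_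
    rw [ENNReal.ofReal_sum_of_nonneg fun i _ => mul_nonneg (bump_nonneg _ _ _) (bump_nonneg _ _ _)]
    rfl
  · intro x
    calc _ ≤ ∑ _i : Fin N, (1 : ℝ) := Finset.sum_le_sum fun i _ =>
          mul_le_one₀ (bump_le_one _ _ _) (bump_nonneg _ _ _) (bump_le_one _ _ _)
      _ = N := by simp
  · exact fun x => Finset.sum_nonneg fun i _ => mul_nonneg (bump_nonneg _ _ _) (bump_nonneg _ _ _)

omit [Fintype κ] in
theorem pairExpect_eq (u : ℝ) (s : Space) :
    pairExpect (antisymmetrize c (blockProduct b φ F)) u s = ENNReal.ofReal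
      (∫ x, ‖antisymmetrize c (blockProduct b φ F) x‖ ^ 2 *
        ∑ q ∈ (Finset.univ : Finset (Fin N)).offDiag,
          (bump u s.1 (x q.1).1 * bump u s.2 (x q.1).2) *
            (bump u s.1 (x q.2).1 * bump u s.2 (x q.2).2)) := by
  have h0 : ∀ x : Space, 0 ≤ bump u s.1 x.1 * bump u s.2 x.2 := fun x =>
    mul_nonneg (bump_nonneg _ _ _) (bump_nonneg _ _ _)
  have h1 : ∀ x : Space, bump u s.1 x.1 * bump u s.2 x.2 ≤ 1 := fun x =>
    mul_le_one₀ (bump_le_one _ _ _) (bump_nonneg _ _ _) (bump_le_one _ _ _)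
  rw [← lintegral_normSq_mul (h.integrable_normSq_antisymmetrize hc) (by fun_prop) ?_
    (C := (Finset.univ : Finset (Fin N)).offDiag.card), pairExpect]
  · refine lintegral_congr fun x => ?_
    rw [ENNReal.ofReal_sum_of_nonneg fun q _ => mul_nonneg (h0 _) (h0 _)]
    simp_rw [ENNReal.ofReal_mul (h0 _)]
    rfl
  · intro x
    calc _ ≤ ∑ _q ∈ (Finset.univ : Finset (Fin N)).offDiag, (1 : ℝ) :=
          Finset.sum_le_sum fun q _ => mul_le_one₀ (h1 _) (h0 _) (h1 _)
      _ = _ := by simp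
  · exact fun x => Finset.sum_nonneg fun q _ => mul_nonneg (h0 _) (h0 _)

-- `hind` is the independence of particles in different blocks along the axis, and `hρ` says that
-- `ρ m` is the axial density of the particles in block `m`.
variable (hind : ∀ (g : ℝ → ℝ) (i j : Fin N), b i ≠ b j →
    axialWeight F g {i, j} = axialWeight F g {i} * axialWeight F g {j})
  {ρ : κ → ℝ → ℝ≥0∞} (hρm : ∀ m, Measurable (ρ m))
  (hρ : ∀ (g : ℝ → ℝ), Measurable g → (∀ z, 0 ≤ g z) → (∀ z, g z ≤ 1) → ∀ m,
    ∑ i with b i = m, ENNReal.ofReal (axialWeight F g {i}) = ∫⁻ z, ρ m z * ENNReal.ofReal (g z))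

include hind hρ in
/-- The square of the density smeared with a Gaussian exceeds the pair expectation at most by a sum
over pairs of blocks, which comes from the self-interaction of the blocks and from exchange. -/
theorem oneExpect_sq_le (u : ℝ) (s : Space) :
    oneExpect (antisymmetrize c (blockProduct b φ F)) u s ^ 2 ≤
      pairExpect (antisymmetrize c (blockProduct b φ F)) u s +
      ∑ m, ∑ m', ‖overlap φ (bump u s.1) m m'‖ₑ ^ 2 *
        ((∫⁻ z, ρ m z * ENNReal.ofReal (bump u s.2 z)) *
          ∫⁻ z, ρ m' z * ENNReal.ofReal (bump u s.2 z)) := by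
  have hm : Measurable (bump u s.2) := by fun_prop
  have hq0 : ∀ i, 0 ≤ axialWeight F (bump u s.2) {i} := fun i =>
    axialWeight_nonneg (bump_nonneg _ _) _
  have key := h.sq_one_body_le hc (g₁ := bump u s.1) (g₂ := bump u s.2) (by fun_prop)
    (bump_nonneg _ _) (bump_le_one _ _) hm (bump_nonneg _ _) (bump_le_one _ _)
    (hind (bump u s.2))
  rw [h.oneExpect_eq hc, h.pairExpect_eq hc, ← ENNReal.ofReal_pow (Finset.sum_nonneg fun i _ =>
    mul_nonneg (orbitalWeight_nonneg (bump_nonneg _ _) _) (hq0 i))]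
  refine (ENNReal.ofReal_le_ofReal key).trans (ENNReal.ofReal_add_le.trans ?_)
  gcongr
  rw [ENNReal.ofReal_sum_of_nonneg fun i _ => Finset.sum_nonneg fun j _ =>
    mul_nonneg (sq_nonneg _) (mul_nonneg (hq0 i) (hq0 j))]
  simp_rw [ENNReal.ofReal_sum_of_nonneg fun j (_ : j ∈ Finset.univ) =>
    mul_nonneg (sq_nonneg ‖overlap φ (bump u s.1) (b _) (b j)‖) (mul_nonneg (hq0 _) (hq0 j)),
    ENNReal.ofReal_mul (sq_nonneg _), ENNReal.ofReal_mul (hq0 _), ← enorm_sq_eq_ofReal,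
    ← hρ _ hm (bump_nonneg _ _) (bump_le_one _ _), Finset.sum_mul_sum]
  refine le_of_eq ?_
  -- Group the particles by blocks.
  rw [← Finset.sum_fiberwise (s := Finset.univ) (g := b)]
  refine Finset.sum_congr rfl fun m _ => ?_
  simp_rw [Finset.mul_sum]
  rw [Finset.sum_comm (s := Finset.univ) (t := Finset.univ.filter fun i => b i = m)]
  refine Finset.sum_congr rfl fun i hi => ?_
  rw [← Finset.sum_fiberwise (s := Finset.univ) (g := b)]
  refine Finset.sum_congr rfl fun m' _ => Finset.sum_congr rfl fun j hj => ?_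
  rw [(Finset.mem_filter.1 hi).2, (Finset.mem_filter.1 hj).2]

include hind hρm hρ in
/-- For the Gaussians of width `1 / u`, the direct energy exceeds the pair energy by at most
`∑ m, ∫ ρ_m ^ 2` times a factor that decays like `u⁻³` for `u ≫ √B`. -/
theorem lintegral_oneExpect_sq_le_of_density {B : ℝ}
    (hdens : ∀ w, ∑ m, ‖φ m w‖ ^ 2 ≤ B / (2 * Real.pi)) {u : ℝ} (hu : 0 < u) :
    ENNReal.ofReal (coulombWeight u) *
        ∫⁻ s, oneExpect (antisymmetrize c (blockProduct b φ F)) u s ^ 2 ≤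
      ENNReal.ofReal (coulombWeight u) *
        (∫⁻ s, pairExpect (antisymmetrize c (blockProduct b φ F)) u s) +
      (∑ m, ∫⁻ z, ρ m z ^ 2) * ENNReal.ofReal (2 / u * min 1 (B / (2 * u ^ 2))) := by
  have hΨ : Measurable (antisymmetrize c (blockProduct b φ F)) := h.measurable_antisymmetrize
  set r : κ → ℝ → ℝ≥0∞ := fun m s => ∫⁻ z, ρ m z * ENNReal.ofReal (bump u s z) with hr
  have hrm : ∀ m, Measurable (r m) := fun m => by
    have := hρm m
    refine Measurable.lintegral_prod_right' (f := fun p : ℝ × ℝ =>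
      ρ m p.2 * ENNReal.ofReal (bump u p.1 p.2)) ?_
    fun_prop
  have hom : ∀ m m', Measurable fun s => ‖overlap φ (bump u s) m m'‖ₑ ^ 2 := fun m m' =>
    (measurable_overlap_bump h.measurable_orbital u m m').enorm.pow_const 2
  set O : κ → κ → ℝ≥0∞ := fun m m' => ∫⁻ s, ‖overlap φ (bump u s) m m'‖ₑ ^ 2 with hO
  have hOsymm : ∀ m m', O m m' = O m' m := fun m m' => by
    refine lintegral_congr fun s => ?_
    rw [overlap_conj φ (bump u s) m' m, ← ofReal_norm, RCLike.norm_conj, ofReal_norm]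
  set R : κ → ℝ≥0∞ := fun m => ∫⁻ s, r m s ^ 2 with hR
  have hpi := Real.pi_pos
  have hB : 0 ≤ B / (2 * Real.pi) :=
    (Finset.sum_nonneg fun _ _ => sq_nonneg _).trans (hdens 0)
  set C : ℝ := min (Real.pi / (4 * u ^ 2)) (B / (2 * Real.pi) * (Real.pi / (2 * u ^ 2)) ^ 2) with hC
  have hOC : ∀ m, ∑ m', O m m' ≤ ENNReal.ofReal C := fun m => by
    rw [hC, ENNReal.ofReal_min]
    exact le_min (sum_lintegral_overlap_le_of_bessel h.measurable_orbital h.orthonormal hu m)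
      (sum_lintegral_overlap_le_of_density h.measurable_orbital h.orthonormal hdens hu m)
  have hmix : ∀ m m', ∫⁻ s, r m s * r m' s ≤ 2⁻¹ * (R m + R m') := fun m m' => by
    rw [hR, ← lintegral_add_left ((hrm m).pow_const 2),
      ← lintegral_const_mul' _ _ (by norm_num)]
    refine lintegral_mono fun s => ?_
    have := mul_le_mul_right (ENNReal.two_mul_mul_le (r m s) (r m' s)) 2⁻¹
    rwa [← mul_assoc, ENNReal.inv_mul_cancel (by norm_num) (by norm_num), one_mul] at this
  have hsplit : ∫⁻ s : Space, ∑ m, ∑ m', ‖overlap φ (bump u s.1) m m'‖ₑ ^ 2 *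
      (r m s.2 * r m' s.2) = ∑ m, ∑ m', O m m' * ∫⁻ s, r m s * r m' s := by
    have hmeas : ∀ m m', Measurable fun s : Space => ‖overlap φ (bump u s.1) m m'‖ₑ ^ 2 *
        (r m s.2 * r m' s.2) := fun m m' =>
      ((hom m m').comp measurable_fst).mul
        (((hrm m).comp measurable_snd).mul ((hrm m').comp measurable_snd))
    rw [lintegral_finsetSum _ fun m _ => Finset.measurable_fun_sum _ fun m' _ => hmeas m m']
    refine Finset.sum_congr rfl fun m _ => ?_
    rw [lintegral_finsetSum _ fun m' _ => hmeas m m']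
    refine Finset.sum_congr rfl fun m' _ => ?_
    exact lintegral_prod_mul (f := fun s => ‖overlap φ (bump u s) m m'‖ₑ ^ 2)
      (g := fun s => r m s * r m' s) (hom m m').aemeasurable ((hrm m).mul (hrm m')).aemeasurable
  have hsum : ∑ m, ∑ m', O m m' * ∫⁻ s, r m s * r m' s ≤
      (∑ m, ∫⁻ z, ρ m z ^ 2) * ENNReal.ofReal (Real.pi / (2 * u ^ 2) * C) := by
    calc _ ≤ ∑ m, ∑ m', O m m' * (2⁻¹ * (R m + R m')) := by
          gcongr with m _ m' _
          exact hmix m m'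
      _ = 2⁻¹ * (∑ m, ∑ m', O m m' * R m) + 2⁻¹ * (∑ m, ∑ m', O m' m * R m') := by
          simp_rw [Finset.mul_sum, ← Finset.sum_add_distrib]
          refine Finset.sum_congr rfl fun m _ => Finset.sum_congr rfl fun m' _ => ?_
          rw [hOsymm m' m]
          ring
      _ = ∑ m, ∑ m', O m m' * R m := by
          rw [Finset.sum_comm (f := fun m m' => O m' m * R m'), ← add_mul,
            ENNReal.inv_two_add_inv_two, one_mul]
      _ ≤ ∑ m, ENNReal.ofReal C * (ENNReal.ofReal (Real.pi / (2 * u ^ 2)) * ∫⁻ z, ρ m z ^ 2) := by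
          refine Finset.sum_le_sum fun m _ => ?_
          rw [← Finset.sum_mul]
          exact mul_le_mul' (hOC m) (lintegral_sq_lintegral_mul_bump_le (hρm m) hu)
      _ = _ := by
          rw [← Finset.mul_sum, ← Finset.mul_sum, ENNReal.ofReal_mul (by positivity)]
          ring
  have hconst : coulombWeight u * (Real.pi / (2 * u ^ 2) * C) =
      2 / u * min 1 (B / (2 * u ^ 2)) := by
    have hs0 : 0 < Real.sqrt Real.pi := Real.sqrt_pos.2 hpi
    have hmin : C = Real.pi / (4 * u ^ 2) * min 1 (B / (2 * u ^ 2)) := by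
      rw [hC, mul_min_of_nonneg _ _ (by positivity), mul_one]
      congr 1
      field_simp
      ring
    rw [hmin, coulombWeight, bumpNormSq]
    have hsq' : Real.sqrt Real.pi ^ 2 = Real.pi := Real.sq_sqrt hpi.le
    field_simp
    rw [hsq']
  have hpair : Measurable (pairExpect (antisymmetrize c (blockProduct b φ F)) u) :=
    (measurable_pairExpect hΨ).of_uncurry_left
  calc _ ≤ ENNReal.ofReal (coulombWeight u) *
        ∫⁻ s, (pairExpect (antisymmetrize c (blockProduct b φ F)) u s +
          ∑ m, ∑ m', ‖overlap φ (bump u s.1) m m'‖ₑ ^ 2 * (r m s.2 * r m' s.2)) := by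
        gcongr with s
        exact h.oneExpect_sq_le hc hind hρ u s
    _ ≤ ENNReal.ofReal (coulombWeight u) *
        ((∫⁻ s, pairExpect (antisymmetrize c (blockProduct b φ F)) u s) +
          (∑ m, ∫⁻ z, ρ m z ^ 2) * ENNReal.ofReal (Real.pi / (2 * u ^ 2) * C)) := by
        rw [lintegral_add_left hpair, hsplit]
        gcongr
    _ = _ := by
        rw [mul_add, mul_left_comm, ← ENNReal.ofReal_mul (coulombWeight_pos hu).le, hconst]

omit [Fintype κ] in
/-- A bound on the Gaussian pair energy by the Gaussian mean, which is integrable in `s`. -/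
theorem pairExpect_le {β : ℝ} {u : ℝ} (s : Space) (hβ : ∀ m, orbitalWeight φ (bump u s.1) m ≤ β) :
    pairExpect (antisymmetrize c (blockProduct b φ F)) u s ≤
      ENNReal.ofReal (2 * N * β) * oneExpect (antisymmetrize c (blockProduct b φ F)) u s := by
  have hm : Measurable (bump u s.2) := by fun_prop
  have ha0 : ∀ m, 0 ≤ orbitalWeight φ (bump u s.1) m := orbitalWeight_nonneg (bump_nonneg _ _)
  have hq0 : ∀ A, 0 ≤ axialWeight F (bump u s.2) A := axialWeight_nonneg (bump_nonneg _ _)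
  rcases Nat.eq_zero_or_pos N with rfl | hN
  · simp [pairExpect]
  have hβ0 : 0 ≤ β := (ha0 (b ⟨0, hN⟩)).trans (hβ _)
  have key := h.integral_pair_le hc (g₁ := bump u s.1) (g₂ := bump u s.2) (by fun_prop)
    (bump_nonneg _ _) (bump_le_one _ _) hm (bump_nonneg _ _) (bump_le_one _ _)
  rw [h.oneExpect_eq hc, h.pairExpect_eq hc, ← ENNReal.ofReal_mul (by positivity)]
  refine ENNReal.ofReal_le_ofReal (key.trans ?_)
  have hmono : ∀ q : Fin N × Fin N, ∀ i ∈ ({q.1, q.2} : Finset (Fin N)),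
      axialWeight F (bump u s.2) {q.1, q.2} ≤ axialWeight F (bump u s.2) {i} := by
    intro q i hi
    refine integral_mono (h.integrable_axial_mul hm (bump_nonneg _ _) (bump_le_one _ _) _)
      (h.integrable_axial_mul hm (bump_nonneg _ _) (bump_le_one _ _) _) fun z => ?_
    refine mul_le_mul_of_nonneg_left ?_ (sq_nonneg _)
    rw [Finset.prod_singleton, ← Finset.mul_prod_erase _ _ hi]
    exact mul_le_of_le_one_right (bump_nonneg _ _ _)
      (Finset.prod_le_one (fun _ _ => bump_nonneg _ _ _) fun _ _ => bump_le_one _ _ _)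
  calc _ ≤ ∑ q ∈ (Finset.univ : Finset (Fin N)).offDiag,
        β * (orbitalWeight φ (bump u s.1) (b q.1) * axialWeight F (bump u s.2) {q.1} +
          orbitalWeight φ (bump u s.1) (b q.2) * axialWeight F (bump u s.2) {q.2}) := by
        refine Finset.sum_le_sum fun q _ => ?_
        rw [add_mul, mul_add]
        have hterm : ∀ i ∈ ({q.1, q.2} : Finset (Fin N)),
            orbitalWeight φ (bump u s.1) (b i) ^ 2 * axialWeight F (bump u s.2) {q.1, q.2} ≤
            β * (orbitalWeight φ (bump u s.1) (b i) * axialWeight F (bump u s.2) {i}) := by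
          intro i hi
          rw [sq, mul_assoc]
          exact mul_le_mul (hβ _) (mul_le_mul_of_nonneg_left (hmono q i hi) (ha0 _))
            (mul_nonneg (ha0 _) (hq0 _)) hβ0
        exact add_le_add (hterm _ (by simp)) (hterm _ (by simp))
    _ ≤ ∑ q : Fin N × Fin N,
        β * (orbitalWeight φ (bump u s.1) (b q.1) * axialWeight F (bump u s.2) {q.1} +
          orbitalWeight φ (bump u s.1) (b q.2) * axialWeight F (bump u s.2) {q.2}) :=
        Finset.sum_le_sum_of_subset_of_nonneg (Finset.subset_univ _) fun q _ _ =>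
          mul_nonneg hβ0 (add_nonneg (mul_nonneg (ha0 _) (hq0 _)) (mul_nonneg (ha0 _) (hq0 _)))
    _ = _ := by
        rw [← Finset.mul_sum, Finset.sum_add_distrib, Fintype.sum_prod_type, Fintype.sum_prod_type]
        simp only [Finset.sum_const, Finset.card_univ, Fintype.card_fin, nsmul_eq_mul,
          ← Finset.mul_sum]
        ring

omit [Fintype κ] hc in
theorem orbitalWeight_bump_le {B : ℝ} (hB : 0 < B)
    (hdens : ∀ m w, ‖φ m w‖ ^ 2 ≤ B / (2 * Real.pi)) {u : ℝ} (hu : 0 < u) (s : ℂ) (m : κ) :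
    orbitalWeight φ (bump u s) m ≤ min 1 (B / (4 * u ^ 2)) := by
  have hpi := Real.pi_pos
  have hm := h.measurable_orbital m
  have h1 := lintegral_normSq_mul (h.integrable_orbital m) (K := bump u s) (by fun_prop)
    (bump_nonneg _ _) (bump_le_one _ _)
  rw [← orbitalWeight] at h1
  rw [← ENNReal.ofReal_le_ofReal_iff (by positivity), ← h1, ENNReal.ofReal_min]
  refine le_min ?_ ?_
  · rw [ENNReal.ofReal_one, ← lintegral_normSq (integral_normSq_orbital h.orthonormal m)]
    refine lintegral_mono fun w => mul_le_of_le_one_right zero_le ?_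
    exact ENNReal.ofReal_le_one.2 (bump_le_one _ _ _)
  · calc _ ≤ ∫⁻ w, ENNReal.ofReal (B / (2 * Real.pi)) * ENNReal.ofReal (bump u s w) := by
          gcongr with w
          rw [enorm_sq_eq_ofReal]
          exact ENNReal.ofReal_le_ofReal (hdens m w)
      _ = _ := by
          rw [lintegral_const_mul _ (by fun_prop), lintegral_bump' hu, gaussian_dim_two,
            ← ENNReal.ofReal_mul (by positivity)]
          congr 1
          field_simp
          ring

omit [Fintype κ] in
/-- The Coulomb energy of a block state is finite. -/
theorem coulombEnergy_ne_top {B : ℝ} (hB : 0 < B)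
    (hdens : ∀ m w, ‖φ m w‖ ^ 2 ≤ B / (2 * Real.pi)) :
    coulombEnergy (antisymmetrize c (blockProduct b φ F)) ≠ ⊤ := by
  have hpi := Real.pi_pos
  have hs0 : 0 < Real.sqrt Real.pi := Real.sqrt_pos.2 hpi
  have hs2 : 0 < Real.sqrt 2 := by positivity
  have hΨ : Measurable (antisymmetrize c (blockProduct b φ F)) := h.measurable_antisymmetrize
  have hnorm := lintegral_normSq (h.norm_antisymmetrize hc)
  set K : ℝ := 2 * N * N * (2 / Real.sqrt Real.pi * (4 / Real.sqrt 2)) with hK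
  have hu : ∀ u ∈ Set.Ioi (0 : ℝ), ENNReal.ofReal (coulombWeight u) *
      ∫⁻ s, pairExpect (antisymmetrize c (blockProduct b φ F)) u s ≤
      ENNReal.ofReal (K * min 1 (B / (4 * u ^ 2))) := by
    intro u hu
    have hu' : 0 < u := hu
    calc _ ≤ ENNReal.ofReal (coulombWeight u) *
          ∫⁻ s, ENNReal.ofReal (2 * N * min 1 (B / (4 * u ^ 2))) *
            oneExpect (antisymmetrize c (blockProduct b φ F)) u s := by
          gcongr with s
          exact h.pairExpect_le hc s (h.orbitalWeight_bump_le hB hdens hu' s.1)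
      _ = _ := by
          rw [lintegral_const_mul' _ _ ENNReal.ofReal_ne_top, lintegral_oneExpect hΨ hnorm hu',
            ← ENNReal.ofReal_natCast, ← ENNReal.ofReal_mul (by positivity),
            ← ENNReal.ofReal_mul (by positivity), ← ENNReal.ofReal_mul (coulombWeight_pos hu').le]
          congr 1
          rw [hK, coulombWeight, bumpNormSq]
          field_simp
  have hfin : ∫⁻ u in Set.Ioi (0 : ℝ), ENNReal.ofReal (K * min 1 (B / (4 * u ^ 2))) < ⊤ := by
    rw [← Set.Ioc_union_Ioi_eq_Ioi (zero_le_one' ℝ)]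
    refine (lintegral_union_le _ _ _).trans_lt (ENNReal.add_lt_top.2 ⟨?_, ?_⟩)
    · calc _ ≤ ∫⁻ u in Set.Ioc (0 : ℝ) 1, ENNReal.ofReal K := by
            refine lintegral_mono fun u => ENNReal.ofReal_le_ofReal ?_
            exact mul_le_of_le_one_right (by positivity) (min_le_left _ _)
        _ < ⊤ := by simp
    · calc _ ≤ ∫⁻ u in Set.Ioi (1 : ℝ), ENNReal.ofReal (K * (B / 4) * u ^ (-2 : ℝ)) := by
            refine setLIntegral_mono (by fun_prop) fun u hu => ENNReal.ofReal_le_ofReal ?_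
            have hu' : 0 < u := lt_trans (zero_lt_one' ℝ) (Set.mem_Ioi.1 hu)
            have hK0 : 0 ≤ K := by positivity
            calc K * min 1 (B / (4 * u ^ 2)) ≤ K * (B / (4 * u ^ 2)) :=
                  mul_le_mul_of_nonneg_left (min_le_right _ _) hK0
              _ = _ := by
                  rw [Real.rpow_neg hu'.le, Real.rpow_two]
                  field_simp
        _ < ⊤ := ((integrableOn_Ioi_rpow_of_lt (by norm_num : (-2 : ℝ) < -1)
            zero_lt_one).const_mul (K * (B / 4))).lintegral_lt_top
  have h2 : 2 * coulombEnergy (antisymmetrize c (blockProduct b φ F)) < ⊤ := by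
    rw [two_mul_coulombEnergy hΨ]
    exact (setLIntegral_mono (by fun_prop) hu).trans_lt hfin
  intro htop
  rw [htop] at h2
  simp at h2

end IsBlockState

end BlockBounds

/-! ### The antisymmetrized state and its axial densities -/

section AntisymmetrizedState

theorem card_blockPerms {ι κ : Type*} [Fintype ι] [DecidableEq ι] [Fintype κ] [DecidableEq κ]
    (b : ι → κ) : (blockPerms b).card = ∏ m, (Fintype.card {p // b p = m}).factorial := by
  rw [← DomMulAct.stabilizer_card b, Fintype.card_subtype, blockPerms]
  simp only [funext_iff, Function.comp_apply]

theorem card_fiber_sigma {κ ι : Type*} [DecidableEq κ] {α : κ → Type*} [∀ m, Fintype (α m)]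
    [Fintype ι] (e : (Σ m, α m) ≃ ι) (m : κ) :
    Fintype.card {p // (e.symm p).1 = m} = Fintype.card (α m) := by
  refine Fintype.card_congr ((e.symm.subtypeEquiv (q := fun x => x.1 = m) fun p => Iff.rfl).trans
    (Equiv.sigmaSubtype m))

variable {M : ℕ} {n : Fin M → ℕ} {ψ : ∀ m : Fin M, Lp ℂ 2 (volume : Measure (Fin (n m) → ℝ))}

/-- The tensor product of the blocks, in the form to which the estimates for block states apply. -/
theorem productState_eq_blockProduct (B : ℝ) (n : Fin M → ℕ)
    (ψ : ∀ m : Fin M, Lp ℂ 2 (volume : Measure (Fin (n m) → ℝ))) :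
    productState B n ψ = blockProduct (fun p => (finSigmaFinEquiv.symm p).1)
      (fun m : Fin M => phi B (m : ℕ)) (axialProduct finSigmaFinEquiv fun m => ψ m) := by
  funext x
  unfold productState blockProduct axialProduct
  rw [Finset.prod_mul_distrib, ← Equiv.prod_comp finSigmaFinEquiv, Fintype.prod_sigma]
  simp

theorem antisymmetrizedState_eq_antisymmetrize (B : ℝ) (n : Fin M → ℕ)
    (ψ : ∀ m : Fin M, Lp ℂ 2 (volume : Measure (Fin (n m) → ℝ))) :
    antisymmetrizedState B n ψ = antisymmetrize
      (Real.sqrt (((∑ m, n m).factorial : ℝ) * ∏ m, ((n m).factorial : ℝ)))⁻¹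
      (blockProduct (fun p => (finSigmaFinEquiv.symm p).1)
        (fun m : Fin M => phi B (m : ℕ)) (axialProduct finSigmaFinEquiv fun m => ψ m)) := by
  rw [← productState_eq_blockProduct]
  rfl

/-- The factor `(N! ∏ m, n_m!) ^ (-1/2)` is the one required by `IsBlockState.norm_antisymmetrize`:
there are `∏ m, n_m!` permutations that preserve the blocks. -/
theorem sq_normalization_mul (n : Fin M → ℕ) :
    (Real.sqrt (((∑ m, n m).factorial : ℝ) * ∏ m, ((n m).factorial : ℝ)))⁻¹ ^ 2 *
      (Fintype.card (Fin (∑ m, n m))).factorial *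
      (blockPerms fun p : Fin (∑ m, n m) => (finSigmaFinEquiv.symm p).1).card = 1 := by
  have h : 0 < ((∑ m, n m).factorial : ℝ) * ∏ m, ((n m).factorial : ℝ) :=
    mul_pos (by positivity) (Finset.prod_pos fun _ _ => by positivity)
  rw [card_blockPerms]
  simp only [card_fiber_sigma, Fintype.card_fin, Nat.cast_prod]
  rw [inv_pow, Real.sq_sqrt h.le, mul_assoc, inv_mul_cancel₀ h.ne']

theorem measurable_coe_Lp (m : Fin M) : Measurable (ψ m) := (Lp.stronglyMeasurable _).measurable

theorem integral_norm_sq_coe_Lp (hnorm : ∀ m, ‖ψ m‖ = 1) (m : Fin M) : ∫ y, ‖ψ m y‖ ^ 2 = 1 := by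
  have h := inner_self_eq_norm_sq_to_K (𝕜 := ℂ) (ψ m)
  rw [hnorm, L2.inner_def] at h
  simp_rw [inner_self_eq_norm_sq_to_K] at h
  have h' : ((∫ y, ‖ψ m y‖ ^ 2 : ℝ) : ℂ) = 1 := by
    rw [← integral_complex_ofReal]
    simpa using h
  exact_mod_cast h'

theorem isBlockState_coe_Lp {B : ℝ} (hB : 0 < B) (hnorm : ∀ m, ‖ψ m‖ = 1)
    (hanti : ∀ m, IsAntisymmetric (ψ m)) :
    IsBlockState (fun p => (finSigmaFinEquiv.symm p).1) (fun m : Fin M => phi B (m : ℕ))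
      (axialProduct finSigmaFinEquiv fun m => ψ m) :=
  isBlockState_axialProduct _ measurable_coe_Lp (integral_norm_sq_coe_Lp hnorm) hanti
    (fun _ => measurable_phi _ _) fun m m' => by
      simp only [integral_conj_phi_mul_phi hB, Fin.val_inj]

/-- The density of `ψ m` is the axial density of the particles in block `m`. -/
theorem sum_axialWeight_eq_lintegral_density (hnorm : ∀ m, ‖ψ m‖ = 1) (g : ℝ → ℝ)
    (hg : Measurable g) (hg0 : ∀ z, 0 ≤ g z) (hg1 : ∀ z, g z ≤ 1) (m : Fin M) :
    ∑ i : Fin (∑ m, n m) with (finSigmaFinEquiv.symm i).1 = m,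
      ENNReal.ofReal (axialWeight (axialProduct finSigmaFinEquiv fun m => ψ m) g {i}) =
    ∫⁻ z, density (fun y => ψ m y) z * ENNReal.ofReal (g z) := by
  have h1 := integral_norm_sq_coe_Lp hnorm
  have hint : Integrable fun y => ‖ψ m y‖ ^ 2 := by
    by_contra hn
    have := h1 m
    rw [integral_undef hn] at this
    exact zero_ne_one this
  rw [lintegral_density_mul (measurable_coe_Lp m) (by fun_prop), Finset.sum_filter,
    ← Equiv.sum_comp finSigmaFinEquiv, Fintype.sum_sigma, Finset.sum_eq_single m]
  · refine Finset.sum_congr rfl fun a _ => ?_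
    rw [Equiv.symm_apply_apply, if_pos rfl, axialWeight_singleton _ h1,
      lintegral_normSq_mul hint (by fun_prop) (fun y => hg0 _) (fun y => hg1 _)]
  · intro m' _ hm
    simp [hm]
  · simp

end AntisymmetrizedState

section DensityPowers

/-- Cauchy-Schwarz for `f ^ 2 = f ^ (1/2) * f ^ (3/2)`. -/
theorem sq_lintegral_sq_le {X : Type*} [MeasurableSpace X] {μ : Measure X} {f : X → ℝ≥0∞}
    (hf : Measurable f) :
    (∫⁻ x, f x ^ 2 ∂μ) ^ 2 ≤ (∫⁻ x, f x ∂μ) * ∫⁻ x, f x ^ 3 ∂μ := by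
  have h := sq_lintegral_mul_le (μ := μ) (f := fun x => f x ^ (1 / 2 : ℝ))
    (g := fun x => f x ^ (3 / 2 : ℝ)) (by fun_prop) (by fun_prop)
  have h1 : ∀ t : ℝ≥0∞, t ^ (1 / 2 : ℝ) * t ^ (3 / 2 : ℝ) = t ^ 2 := fun t => by
    rw [← ENNReal.rpow_add_of_nonneg _ _ (by norm_num) (by norm_num), ← ENNReal.rpow_two]
    norm_num
  have h2 : ∀ t : ℝ≥0∞, (t ^ (1 / 2 : ℝ)) ^ 2 = t := fun t => by
    rw [← ENNReal.rpow_natCast, ← ENNReal.rpow_mul]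
    norm_num
  have h3 : ∀ t : ℝ≥0∞, (t ^ (3 / 2 : ℝ)) ^ 2 = t ^ 3 := fun t => by
    rw [← ENNReal.rpow_natCast, ← ENNReal.rpow_mul, ← ENNReal.rpow_natCast]
    norm_num
  simpa only [h1, h2, h3] using h

variable {M : ℕ} {n : Fin M → ℕ} {ψ : ∀ m : Fin M, Lp ℂ 2 (volume : Measure (Fin (n m) → ℝ))}

theorem lintegral_density_coe_Lp (hnorm : ∀ m, ‖ψ m‖ = 1) (m : Fin M) :
    ∫⁻ z, density (fun y => ψ m y) z = n m := by
  have h := lintegral_density_mul (measurable_coe_Lp (ψ := ψ) m)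
    (f := fun _ => 1) measurable_const
  simpa [lintegral_normSq (integral_norm_sq_coe_Lp hnorm m)] using h

/-- Cauchy-Schwarz for the densities of all blocks at once, on the disjoint union of `M` lines. -/
theorem sq_sum_lintegral_density_sq_le (hnorm : ∀ m, ‖ψ m‖ = 1) :
    (∑ m, ∫⁻ z, density (fun y => ψ m y) z ^ 2) ^ 2 ≤ (∑ m, n m : ℕ) * sumCubes n ψ := by
  set f : Fin M × ℝ → ℝ≥0∞ := fun p => density (fun y => ψ p.1 y) p.2 with hf
  have hfm : Measurable f := measurable_from_prod_countable_right fun m =>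
    measurable_density (measurable_coe_Lp m)
  have hprod : ∀ k : ℕ, ∫⁻ p, f p ^ k ∂(Measure.count.prod volume) =
      ∑ m, ∫⁻ z, density (fun y => ψ m y) z ^ k := fun k => by
    rw [lintegral_prod _ (by fun_prop), lintegral_count, tsum_fintype]
  have h := sq_lintegral_sq_le (μ := Measure.count.prod volume) hfm
  have h1 := hprod 1
  simp only [pow_one, lintegral_density_coe_Lp hnorm] at h1
  rw [hprod, hprod, h1] at h
  simpa [sumCubes] using h

theorem sum_eq_zero_of_sumCubes_eq_zero (hnorm : ∀ m, ‖ψ m‖ = 1) (h : sumCubes n ψ = 0) :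
    ∑ m, n m = 0 := by
  refine Finset.sum_eq_zero fun m _ => ?_
  have hm : ∫⁻ z, density (fun y => ψ m y) z ^ 3 = 0 :=
    Finset.sum_eq_zero_iff.1 h m (Finset.mem_univ m)
  have hρ : Measurable (density fun y => ψ m y) := measurable_density (measurable_coe_Lp m)
  rw [lintegral_eq_zero_iff (by fun_prop)] at hm
  have h0 : ∫⁻ z, density (fun y => ψ m y) z = 0 := by
    rw [lintegral_eq_zero_iff hρ]
    filter_upwards [hm] with z hz
    exact pow_eq_zero_iff (three_ne_zero) |>.1 hz
  rw [lintegral_density_coe_Lp hnorm] at h0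
  exact_mod_cast h0

end DensityPowers

/-! ### Comparison of the energies -/

section Estimate

/-- The integral over `u` of the short-range error: `2 / u` for `u ≤ a`, and the decay `B / u ^ 3`,
which sets in at `u = √(B / 2)`, for `u ≥ a`. -/
theorem lintegral_two_div_mul_min_le {B U a : ℝ} (hU : 0 < U) (hUa : U ≤ a)
    (ha : B / 2 ≤ a ^ 2) :
    ∫⁻ u in Set.Ioi U, ENNReal.ofReal (2 / u * min 1 (B / (2 * u ^ 2))) ≤
      ENNReal.ofReal (2 * Real.log (a / U) + 1) := by
  have ha0 : 0 < a := hU.trans_le hUa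
  rcases le_or_gt B 0 with hB | hB
  · refine le_of_eq_of_le ?_ zero_le
    rw [setLIntegral_congr_fun measurableSet_Ioi (g := fun _ => 0), lintegral_zero]
    intro u hu
    have hu' : 0 < u := hU.trans hu
    refine ENNReal.ofReal_of_nonpos (mul_nonpos_of_nonneg_of_nonpos (by positivity)
      ((min_le_right _ _).trans (div_nonpos_of_nonpos_of_nonneg hB (by positivity))))
  have hnear : ∫⁻ u in Set.Ioc U a, ENNReal.ofReal (2 / u * min 1 (B / (2 * u ^ 2))) ≤
      ENNReal.ofReal (2 * Real.log (a / U)) := by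
    calc _ ≤ ∫⁻ u in Set.Ioc U a, ENNReal.ofReal (2 * (1 / u)) := by
          refine setLIntegral_mono (by fun_prop) fun u hu => ENNReal.ofReal_le_ofReal ?_
          have hu' : 0 < u := hU.trans hu.1
          calc 2 / u * min 1 (B / (2 * u ^ 2)) ≤ 2 / u :=
                mul_le_of_le_one_right (by positivity) (min_le_left _ _)
            _ = _ := by ring
      _ = _ := by
          have hint : IntervalIntegrable (fun u : ℝ => 2 * (1 / u)) volume U a :=
            ((intervalIntegral.intervalIntegrable_one_div (fun x hx => by
              rw [Set.uIcc_of_le hUa] at hx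
              exact (hU.trans_le hx.1).ne') continuousOn_id)).const_mul 2
          rw [← ofReal_integral_eq_lintegral_ofReal
            ((intervalIntegrable_iff_integrableOn_Ioc_of_le hUa).1 hint) ?_,
            ← intervalIntegral.integral_of_le hUa, intervalIntegral.integral_const_mul,
            integral_one_div_of_pos hU ha0]
          refine (ae_restrict_mem measurableSet_Ioc).mono fun u hu => ?_
          have hu' : 0 < u := hU.trans hu.1
          show (0 : ℝ) ≤ 2 * (1 / u)
          positivity
  have hfar : ∫⁻ u in Set.Ioi a, ENNReal.ofReal (2 / u * min 1 (B / (2 * u ^ 2))) ≤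
      ENNReal.ofReal 1 := by
    calc _ ≤ ∫⁻ u in Set.Ioi a, ENNReal.ofReal (B * u ^ (-3 : ℝ)) := by
          refine setLIntegral_mono (by fun_prop) fun u hu => ENNReal.ofReal_le_ofReal ?_
          have hu' : 0 < u := ha0.trans hu
          calc 2 / u * min 1 (B / (2 * u ^ 2)) ≤ 2 / u * (B / (2 * u ^ 2)) :=
                mul_le_mul_of_nonneg_left (min_le_right _ _) (by positivity)
            _ = _ := by
                rw [Real.rpow_neg hu'.le, show (3 : ℝ) = (3 : ℕ) by norm_num, Real.rpow_natCast]
                field_simp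
      _ ≤ _ := by
          rw [← ofReal_integral_eq_lintegral_ofReal
            ((integrableOn_Ioi_rpow_of_lt (by norm_num) ha0).const_mul B) ?_,
            integral_const_mul, integral_Ioi_rpow_of_lt (by norm_num) ha0]
          · refine ENNReal.ofReal_le_ofReal ?_
            rw [show (-3 : ℝ) + 1 = -2 by norm_num, Real.rpow_neg ha0.le, Real.rpow_two]
            rw [show B * (-(a ^ 2)⁻¹ / -2) = B / 2 / a ^ 2 by field_simp]
            exact (div_le_one (by positivity)).2 ha
          · refine (ae_restrict_mem measurableSet_Ioi).mono fun u hu => ?_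
            have hu' : 0 < u := ha0.trans hu
            show (0 : ℝ) ≤ B * u ^ (-3 : ℝ)
            positivity
  rw [← Set.Ioc_union_Ioi_eq_Ioi hUa, ENNReal.ofReal_add
    (mul_nonneg zero_le_two (Real.log_nonneg ((one_le_div hU).2 hUa))) zero_le_one]
  exact (lintegral_union_le _ _ _).trans (add_le_add hnear hfar)

variable {M : ℕ} {n : Fin M → ℕ} {ψ : ∀ m : Fin M, Lp ℂ 2 (volume : Measure (Fin (n m) → ℝ))}
  {B : ℝ}

theorem measurable_antisymmetrizedState : Measurable (antisymmetrizedState B n ψ) := by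
  have hψ : ∀ m, Measurable (ψ m) := fun m => measurable_coe_Lp m
  have hφ : ∀ m, Measurable (phi B m) := measurable_phi B
  unfold antisymmetrizedState productState
  fun_prop

theorem lintegral_normSq_antisymmetrizedState (hB : 0 < B) (hnorm : ∀ m, ‖ψ m‖ = 1)
    (hanti : ∀ m, IsAntisymmetric (ψ m)) : ∫⁻ x, ‖antisymmetrizedState B n ψ x‖ₑ ^ 2 = 1 := by
  rw [antisymmetrizedState_eq_antisymmetrize]
  exact lintegral_normSq ((isBlockState_coe_Lp hB hnorm hanti).norm_antisymmetrize
    (sq_normalization_mul n))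

theorem coulombEnergy_antisymmetrizedState_ne_top (hB : 0 < B) (hnorm : ∀ m, ‖ψ m‖ = 1)
    (hanti : ∀ m, IsAntisymmetric (ψ m)) : coulombEnergy (antisymmetrizedState B n ψ) ≠ ⊤ := by
  rw [antisymmetrizedState_eq_antisymmetrize]
  refine (isBlockState_coe_Lp hB hnorm hanti).coulombEnergy_ne_top (sq_normalization_mul n) hB
    fun m w => ?_
  exact (Finset.single_le_sum (f := fun m : Fin M => ‖phi B (m : ℕ) w‖ ^ 2)
    (fun _ _ => sq_nonneg _) (Finset.mem_univ m)).trans (sum_norm_phi_sq_le hB M w)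

/-- The comparison of the direct energy with the Coulomb energy, for an arbitrary separation of
the Gaussians into long-range ones (`u ≤ U`) and short-range ones (`u > U`). -/
theorem two_mul_directEnergy_le (hB : 0 < B) (hnorm : ∀ m, ‖ψ m‖ = 1)
    (hanti : ∀ m, IsAntisymmetric (ψ m)) {U : ℝ} (hU : 0 < U) :
    2 * directEnergy (density (antisymmetrizedState B n ψ)) ≤
      2 * coulombEnergy (antisymmetrizedState B n ψ) +
      (((∑ m, n m : ℕ) : ℝ≥0∞) * ENNReal.ofReal (2 / Real.sqrt Real.pi) * ENNReal.ofReal U +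
      (∑ m, ∫⁻ z, density (fun y => ψ m y) z ^ 2) *
        ∫⁻ u in Set.Ioi U, ENNReal.ofReal (2 / u * min 1 (B / (2 * u ^ 2)))) := by
  have hΨ : Measurable (antisymmetrizedState B n ψ) := measurable_antisymmetrizedState
  have hb := isBlockState_coe_Lp hB hnorm hanti
  rw [two_mul_directEnergy hΨ, two_mul_coulombEnergy hΨ, ← Set.Ioc_union_Ioi_eq_Ioi hU.le,
    lintegral_union measurableSet_Ioi Set.Ioc_disjoint_Ioi_same,
    lintegral_union measurableSet_Ioi Set.Ioc_disjoint_Ioi_same, add_add_add_comm]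
  have hpm : Measurable fun u => ENNReal.ofReal (coulombWeight u) *
      ∫⁻ s, pairExpect (antisymmetrizedState B n ψ) u s := by
    have h1 := measurable_coulombWeight
    have h2 : Measurable fun u => ∫⁻ s, pairExpect (antisymmetrizedState B n ψ) u s :=
      (measurable_pairExpect hΨ).lintegral_prod_right'
    fun_prop
  refine add_le_add ?_ ?_
  -- Long range: the error per unit of `u` does not depend on `u`.
  · calc _ ≤ ∫⁻ u in Set.Ioc 0 U, (ENNReal.ofReal (coulombWeight u) *
          (∫⁻ s, pairExpect (antisymmetrizedState B n ψ) u s) +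
          ((∑ m, n m : ℕ) : ℝ≥0∞) * ENNReal.ofReal (2 / Real.sqrt Real.pi)) :=
        setLIntegral_mono (by fun_prop) fun u hu => lintegral_oneExpect_sq_le hΨ
          (lintegral_normSq_antisymmetrizedState hB hnorm hanti) hu.1
      _ = _ := by
        rw [lintegral_add_left hpm, setLIntegral_const, Real.volume_Ioc, sub_zero]
  -- Short range.
  · calc _ ≤ ∫⁻ u in Set.Ioi U, (ENNReal.ofReal (coulombWeight u) *
          (∫⁻ s, pairExpect (antisymmetrizedState B n ψ) u s) +
          (∑ m, ∫⁻ z, density (fun y => ψ m y) z ^ 2) *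
            ENNReal.ofReal (2 / u * min 1 (B / (2 * u ^ 2)))) := by
          refine setLIntegral_mono (by fun_prop) fun u hu => ?_
          rw [antisymmetrizedState_eq_antisymmetrize]
          exact hb.lintegral_oneExpect_sq_le_of_density (sq_normalization_mul n)
            (fun g i j hij => axialWeight_pair _ (integral_norm_sq_coe_Lp hnorm) g hij)
            (fun m => measurable_density (measurable_coe_Lp m))
            (fun g hg hg0 hg1 m => sum_axialWeight_eq_lintegral_density hnorm g hg hg0 hg1 m)
            (sum_norm_phi_sq_le hB M) (hU.trans hu)
      _ = _ := by
        rw [lintegral_add_left hpm, lintegral_const_mul _ (by fun_prop)]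

/-- Without particles, the Cauchy-Schwarz bound has no error term. -/
theorem two_mul_directEnergy_le_of_sum_eq_zero (hB : 0 < B) (hnorm : ∀ m, ‖ψ m‖ = 1)
    (hanti : ∀ m, IsAntisymmetric (ψ m)) (hN : ∑ m, n m = 0) :
    2 * directEnergy (density (antisymmetrizedState B n ψ)) ≤
      2 * coulombEnergy (antisymmetrizedState B n ψ) := by
  have hΨ : Measurable (antisymmetrizedState B n ψ) := measurable_antisymmetrizedState
  rw [two_mul_directEnergy hΨ, two_mul_coulombEnergy hΨ]
  refine setLIntegral_mono' measurableSet_Ioi fun u hu => ?_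
  simpa [hN] using lintegral_oneExpect_sq_le hΨ
    (lintegral_normSq_antisymmetrizedState hB hnorm hanti) hu

/-- The bound with explicit constants. The Gaussians are separated at `U = √(S / N)`, and `a` below
is the maximum of `U` and `√B`. -/
theorem directEnergy_le (hB : 0 < B) (hnorm : ∀ m, ‖ψ m‖ = 1)
    (hanti : ∀ m, IsAntisymmetric (ψ m)) (hfin : sumCubes n ψ ≠ ⊤)
    {N S L : ℝ} (hN : N = (∑ m, n m : ℕ)) (hS : S = (sumCubes n ψ).toReal)
    (hL0 : 0 ≤ L) (hL : Real.log (max 1 (Real.sqrt (B * N / S))) ≤ L) :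
    2 * directEnergy (density (antisymmetrizedState B n ψ)) ≤
      2 * coulombEnergy (antisymmetrizedState B n ψ) +
        ENNReal.ofReal (2 * (Real.sqrt N * Real.sqrt S * (L + 2))) := by
  have hS0 : 0 ≤ S := hS ▸ ENNReal.toReal_nonneg
  have hN0 : 0 ≤ N := hN ▸ Nat.cast_nonneg _
  by_cases hNz : ∑ m, n m = 0
  · exact (two_mul_directEnergy_le_of_sum_eq_zero hB hnorm hanti hNz).trans le_self_add
  have hNpos : 0 < N := lt_of_le_of_ne hN0 (by rw [hN]; exact_mod_cast (Ne.symm hNz))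
  have hSpos : 0 < S := by
    refine lt_of_le_of_ne hS0 fun h => hNz (sum_eq_zero_of_sumCubes_eq_zero hnorm ?_)
    rw [hS] at h
    exact ((ENNReal.toReal_eq_zero_iff _).1 h.symm).resolve_right hfin
  have hsN : 0 < Real.sqrt N := Real.sqrt_pos.2 hNpos
  have hsS : 0 < Real.sqrt S := Real.sqrt_pos.2 hSpos
  set Q : ℝ := Real.sqrt N * Real.sqrt S with hQ
  have hQ0 : 0 ≤ Q := by positivity
  have hQle : ∑ m, ∫⁻ z, density (fun y => ψ m y) z ^ 2 ≤ ENNReal.ofReal Q := by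
    have h := sq_sum_lintegral_density_sq_le hnorm
    rw [← ENNReal.ofReal_toReal hfin, ← hS, ← ENNReal.ofReal_natCast, ← hN,
      ← ENNReal.ofReal_mul hN0] at h
    refine (ENNReal.pow_le_pow_left_iff two_ne_zero).1 (h.trans_eq ?_)
    rw [← ENNReal.ofReal_pow hQ0, hQ, mul_pow, Real.sq_sqrt hN0, Real.sq_sqrt hS0]
  set U : ℝ := Real.sqrt S / Real.sqrt N with hU
  have hU0 : 0 < U := by positivity
  set a : ℝ := U * max 1 (Real.sqrt (B * N / S)) with ha
  have hUa : U ≤ a := le_mul_of_one_le_right hU0.le (le_max_left _ _)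
  have haB : B / 2 ≤ a ^ 2 := by
    have h1 : U * Real.sqrt (B * N / S) ≤ a :=
      mul_le_mul_of_nonneg_left (le_max_right _ _) hU0.le
    have h2 : (U * Real.sqrt (B * N / S)) ^ 2 = B := by
      rw [mul_pow, Real.sq_sqrt (by positivity), hU, div_pow, Real.sq_sqrt hN0, Real.sq_sqrt hS0]
      field_simp
    have h3 := pow_le_pow_left₀ (by positivity) h1 2
    linarith
  have haU : a / U = max 1 (Real.sqrt (B * N / S)) := by
    rw [ha]
    field_simp
  refine (two_mul_directEnergy_le hB hnorm hanti hU0).trans ?_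
  gcongr
  have hpi : 2 / Real.sqrt Real.pi ≤ 2 := by
    refine div_le_self zero_le_two ?_
    rw [Real.one_le_sqrt]
    linarith [Real.pi_gt_three]
  have hNU : N * U = Q := by
    rw [hU, hQ]
    field_simp
    exact (Real.sq_sqrt hN0).symm
  calc _ ≤ ENNReal.ofReal (2 * Q) + ENNReal.ofReal Q * ENNReal.ofReal (2 * L + 1) := by
        refine add_le_add ?_ (mul_le_mul' hQle
          ((lintegral_two_div_mul_min_le hU0 hUa haB).trans (ENNReal.ofReal_le_ofReal ?_)))
        · rw [← ENNReal.ofReal_natCast, ← hN, ← ENNReal.ofReal_mul hN0,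
            ← ENNReal.ofReal_mul (by positivity)]
          refine ENNReal.ofReal_le_ofReal ?_
          rw [mul_right_comm, hNU, mul_comm]
          exact mul_le_mul_of_nonneg_right hpi hQ0
        · rw [haU]
          linarith
    _ ≤ _ := by
        rw [← ENNReal.ofReal_mul hQ0, ← ENNReal.ofReal_add (by positivity) (by positivity)]
        refine ENNReal.ofReal_le_ofReal ?_
        nlinarith

end Estimate

end LandauBand

end

theorem mainTheorem4 (B : ℝ) (hB : 0 < B) (M : ℕ) (n : Fin M → ℕ)
    (ψ : ∀ m : Fin M, Lp ℂ 2 (volume : Measure (Fin (n m) → ℝ)))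
    (hnorm : ∀ m, ‖ψ m‖ = 1)
    (hanti : ∀ m, LandauBand.IsAntisymmetric (ψ m))
    (hfin : LandauBand.sumCubes n ψ ≠ ⊤) :
    let N : ℕ := ∑ m, n m
    let Ψ : (Fin N → LandauBand.Space) → ℂ := LandauBand.antisymmetrizedState B n ψ
    let D : ℝ≥0∞ := LandauBand.directEnergy (LandauBand.density Ψ)
    let S : ℝ := (LandauBand.sumCubes n ψ).toReal
    LandauBand.coulombEnergy Ψ ≠ ⊤ ∧ D ≠ ⊤ ∧
      D.toReal - Real.sqrt (N : ℝ) * Real.sqrt S *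
          (33 / 2 * Real.log (Real.exp 3 + Real.sqrt (B * (N : ℝ) / S)) + 33
            + 1 / 4 * Real.log (Real.pi / 2)) ≤
        (LandauBand.coulombEnergy Ψ).toReal := by
  intro N Ψ D S
  have hE : LandauBand.coulombEnergy Ψ ≠ ⊤ :=
    LandauBand.coulombEnergy_antisymmetrizedState_ne_top hB hnorm hanti
  set L : ℝ := Real.log (Real.exp 3 + Real.sqrt (B * (N : ℝ) / S)) with hLdef
  have hx : 0 ≤ Real.sqrt (B * (N : ℝ) / S) := Real.sqrt_nonneg _
  have he : 1 ≤ Real.exp 3 := Real.one_le_exp (by norm_num)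
  have hL0 : 0 ≤ L := Real.log_nonneg (by linarith)
  have hL : Real.log (max 1 (Real.sqrt (B * (N : ℝ) / S))) ≤ L :=
    Real.log_le_log (lt_max_of_lt_left one_pos) (max_le (by linarith) (by linarith))
  have key : 2 * D ≤ 2 * LandauBand.coulombEnergy Ψ +
      ENNReal.ofReal (2 * (Real.sqrt N * Real.sqrt S * (L + 2))) :=
    LandauBand.directEnergy_le hB hnorm hanti hfin rfl rfl hL0 hL
  have hQ : 0 ≤ Real.sqrt (N : ℝ) * Real.sqrt S := by positivity
  have hrhs : 2 * LandauBand.coulombEnergy Ψ +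
      ENNReal.ofReal (2 * (Real.sqrt N * Real.sqrt S * (L + 2))) ≠ ⊤ :=
    ENNReal.add_ne_top.2 ⟨ENNReal.mul_ne_top (by norm_num) hE, ENNReal.ofReal_ne_top⟩
  have hD : D ≠ ⊤ := fun h => hrhs (top_le_iff.1 (by simpa [h] using key))
  refine ⟨hE, hD, ?_⟩
  have hreal := ENNReal.toReal_mono hrhs key
  rw [ENNReal.toReal_add (ENNReal.mul_ne_top (by norm_num) hE) ENNReal.ofReal_ne_top,
    ENNReal.toReal_mul, ENNReal.toReal_mul, ENNReal.toReal_ofReal (by positivity)] at hreal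
  simp only [ENNReal.toReal_ofNat] at hreal
  have hpi : 0 ≤ Real.log (Real.pi / 2) := Real.log_nonneg (by linarith [Real.pi_gt_three])
  have hle : Real.sqrt N * Real.sqrt S * (L + 2) ≤ Real.sqrt (N : ℝ) * Real.sqrt S *
      (33 / 2 * L + 33 + 1 / 4 * Real.log (Real.pi / 2)) :=
    mul_le_mul_of_nonneg_left (by linarith) hQ
  linarith
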